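/- Let $\Gamma=\mathbb R_+^\times$; all graded rings are commutative and $\Gamma$-graded. A graded field is a nonzero graded ring all of whose nonzero homogeneous elements are invertible; $\rho$ denotes the degree of a homogeneous unit. Let $k$ be a graded field whose degree-$1$ part $k_1$ has characteristic $p>0$ (equivalently, $k$ has characteristic $p$), let $\bar k$ be a graded algebraic closure of $k$, let $n\ge 1$, and let $\ell=k^{p^{-n}}:=\{x\in\bar k: x^{p^n}\in k\}$, a graded subring of $\bar k$. For $r_1,\dots,r_d\in\Gamma$ let $k[r_1^{-1}T_1,\dots,r_d^{-1}T_d]$ be the polynomial ring graded so that $aT_1^{i_1}\cdots T_d^{i_d}$ has degree $\rho(a)r_1^{i_1}\cdots r_d^{i_d}$ for $a\in k$ nonzero and homogeneous. Let $r\in\Gamma$ and $B=k[r^{-1}T]$. A graded $k$-algebra $A$ is a graded form of $B$ over $\ell/k$ if there is a degree-preserving isomorphism of graded $\ell$-algebras $\ell\otimes_kA\cong\ell\otimes_kB$. A graded Hopf $k$-algebra is a commutative graded $k$-algebra with a Hopf algebra structure over $k$ whose comultiplication, augmentation and antipode preserve degrees. (1) Let $s\in\rho(\ell^\times)r$ and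 let $f(T_1)=a_0T_1+a_1T_1^p+\dots+a_mT_1^{p^m}\in k[r^{-p^n}T_1]$ be a $p$-polynomial, homogeneous of degree $s^{p^n}$, with $a_0\neq0$. Then $$A=k[r^{-p^n}T_1,s^{-1}T_2]/(T_2^{p^n}-f(T_1)),$$ with the quotient grading and the Hopf structure induced by the two-dimensional additive group ($T_i\mapsto T_i\otimes1+1\otimes T_i$, with unit element $T_1=T_2=0$), is a graded Hopf $k$-algebra and a graded form of $B$ over $\ell/k$. (2) Conversely, every graded Hopf $k$-algebra which is, as a graded $k$-algebra, a graded form of $B$ over $\ell/k$ is isomorphic, as a graded Hopf $k$-algebra, to one of the algebras in (1) for some $s\in\rho(\ell^\times)r$, some $m\ge0$ and some such $f$. -/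

import Mathlib

open scoped TensorProduct

noncomputable section

namespace RussellGraded

universe u v w

/-! ### Graded rings, graded fields, polynomial extensions -/

/-- The grading group `ℝ_+^×` of positive real numbers under multiplication. Mathlib's graded rings
are indexed by additive monoids, so the group is written additively: `γ + δ` is the product of `γ`
and `δ`, `0` is the real number `1`, and `m • γ` is the `m`-th power of `γ`. -/
abbrev Degree : Type := Additive {x : ℝ // 0 < x}

/-- A graded field: a graded ring, nonzero, whose nonzero homogeneous elements are invertible. -/
structure IsGradedField {k : Type u} [CommRing k] (𝒦 : Degree → AddSubgroup k) : Prop where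
  graded : Nonempty (GradedRing 𝒦)
  nontrivial : Nontrivial k
  isUnit_of_ne_zero : ∀ (γ : Degree) (x : k), x ∈ 𝒦 γ → x ≠ 0 → IsUnit x

/-- The image `ρ(A^×)` of the group of invertible homogeneous elements under the grading. -/
def unitDegrees {A : Type u} [CommRing A] (𝒜 : Degree → AddSubgroup A) : Set Degree :=
  {γ | ∃ a : A, IsUnit a ∧ a ∈ 𝒜 γ}

/-- The degree `γ` part of the graded ring `A[r⁻¹T]`: the polynomials `∑ aᵢ Tⁱ` with `aᵢ`
homogeneous of degree `γ r⁻ⁱ`. -/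
def polyGrade {A : Type u} [CommRing A] (𝒜 : Degree → AddSubgroup A) (r γ : Degree) :
    AddSubgroup (Polynomial A) where
  carrier := {f | ∀ i : ℕ, f.coeff i ∈ 𝒜 (γ - i • r)}
  zero_mem' := fun i => by simp
  add_mem' := fun hf hg i => by
    rw [Polynomial.coeff_add]; exact add_mem (hf i) (hg i)
  neg_mem' := fun hf i => by
    rw [Polynomial.coeff_neg]; exact neg_mem (hf i)

/-- The degree `γ` part of the graded ring `A[r₁⁻¹T₁, …, r_d⁻¹T_d]`: the polynomials `∑ a_I T^I`
with `a_I` homogeneous of degree `γ r^{-I}`. -/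
def mvPolyGrade {A : Type u} [CommRing A] (𝒜 : Degree → AddSubgroup A) {d : ℕ}
    (r : Fin d → Degree) (γ : Degree) : AddSubgroup (MvPolynomial (Fin d) A) where
  carrier := {f | ∀ I : Fin d →₀ ℕ, f.coeff I ∈ 𝒜 (γ - ∑ j, I j • r j)}
  zero_mem' := fun i => by simp
  add_mem' := fun hf hg i => by
    rw [MvPolynomial.coeff_add]; exact add_mem (hf i) (hg i)
  neg_mem' := fun hf i => by
    rw [MvPolynomial.coeff_neg]; exact neg_mem (hf i)

/-- The tensor product grading: the degree `γ` part of `M ⊗ N` is `∑_{δτ = γ} M_δ ⊗ N_τ`. -/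
def tensorGrade (R : Type u) [CommRing R] {M : Type v} {N : Type w} [CommRing M] [CommRing N]
    [Algebra R M] [Algebra R N] (ℳ : Degree → AddSubgroup M) (𝒩 : Degree → AddSubgroup N)
    (γ : Degree) : AddSubgroup (M ⊗[R] N) :=
  AddSubgroup.closure
    {z | ∃ δ τ : Degree, δ + τ = γ ∧ ∃ x ∈ ℳ δ, ∃ y ∈ 𝒩 τ, z = x ⊗ₜ[R] y}

/-- `A` with the grading `𝒜` is a graded algebra over `k` with the grading `𝒦`: it is a graded
ring, and the structure homomorphism is graded of degree `1`. -/
structure IsGradedAlgebra {k : Type u} {A : Type v} [CommRing k] [CommRing A] [Algebra k A]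
    (𝒦 : Degree → AddSubgroup k) (𝒜 : Degree → AddSubgroup A) : Prop where
  graded : Nonempty (GradedRing 𝒜)
  algebraMap_mem : ∀ (γ : Degree) (x : k), x ∈ 𝒦 γ → algebraMap k A x ∈ 𝒜 γ

/-- `K` is a graded algebraic closure of the graded field `k`: a graded field extension, all of
whose homogeneous elements are algebraic over `k`, in which every homogeneous polynomial of
positive monomial degree of `K[r⁻¹T]`, for any `r`, has a root that is homogeneous of degree
`r` (or zero). -/
structure IsGradedAlgClosure {k : Type u} {K : Type v} [CommRing k] [CommRing K] [Algebra k K]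
    (𝒦 : Degree → AddSubgroup k) (ℋ : Degree → AddSubgroup K) : Prop where
  isGradedField : IsGradedField ℋ
  isGradedAlgebra : IsGradedAlgebra 𝒦 ℋ
  isAlgebraic : ∀ (γ : Degree) (x : K), x ∈ ℋ γ → IsAlgebraic k x
  exists_root : ∀ (r γ : Degree) (f : Polynomial K), f ∈ polyGrade ℋ r γ → 0 < f.natDegree →
    ∃ x ∈ ℋ r, f.eval x = 0

/-- `k^{p^{-n}}`, the elements `x` of the extension `K` with `x^{p^n} ∈ k`. For `n = 0` this is
the image of `k`. As `1` lies in the degree one part, `k` has characteristic `p` if and only if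
its degree one part has. -/
def rootSubalgebra (p n : ℕ) [Fact p.Prime] (k : Type u) (K : Type v) [CommRing k] [CharP k p]
    [CommRing K] [Algebra k K] : Subalgebra k K where
  carrier := {x | ∃ a : k, algebraMap k K a = x ^ p ^ n}
  mul_mem' := by
    rintro x y ⟨a, ha⟩ ⟨b, hb⟩
    exact ⟨a * b, by rw [map_mul, ha, hb, mul_pow]⟩
  add_mem' := by
    rintro x y ⟨a, ha⟩ ⟨b, hb⟩
    obtain ⟨z, hz⟩ := exists_add_pow_prime_pow_eq (Fact.out : p.Prime) x y n
    have hp : (p : K) = 0 := by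
      rw [← map_natCast (algebraMap k K) p, CharP.cast_eq_zero, map_zero]
    exact ⟨a + b, by rw [hz, hp, map_add, ha, hb]; ring⟩
  algebraMap_mem' := fun a => ⟨a ^ p ^ n, map_pow _ _ _⟩

/-- The grading of `k^{p^{-n}}` as a graded subring of `K`. -/
def rootGrade (p n : ℕ) [Fact p.Prime] (k : Type u) {K : Type v} [CommRing k] [CharP k p]
    [CommRing K] [Algebra k K] (ℋ : Degree → AddSubgroup K) (γ : Degree) :
    AddSubgroup (rootSubalgebra p n k K) :=
  (ℋ γ).comap (rootSubalgebra p n k K).val.toRingHom.toAddMonoidHom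

/-! ### Graded forms and graded Hopf algebras -/

/-- `A` is a graded form of `B` with respect to the extension `L` of `k`: there is an isomorphism
of graded `L`-algebras (of degree `1`) between `L ⊗ A` and `L ⊗ B`. -/
def IsGradedForm (k : Type u) {L : Type v} {A B : Type*} [CommRing k] [CommRing L] [CommRing A]
    [CommRing B] [Algebra k L] [Algebra k A] [Algebra k B] (ℒ : Degree → AddSubgroup L)
    (𝒜 : Degree → AddSubgroup A) (ℬ : Degree → AddSubgroup B) : Prop :=
  ∃ e : (L ⊗[k] A) ≃ₐ[L] (L ⊗[k] B),
    ∀ (γ : Degree) (z : L ⊗[k] A), e z ∈ tensorGrade k ℒ ℬ γ ↔ z ∈ tensorGrade k ℒ 𝒜 γ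

/-- A graded Hopf algebra: a graded algebra with a Hopf algebra structure whose comultiplication,
augmentation and antipode are graded homomorphisms of degree `1`. -/
structure IsGradedHopfAlgebra {k : Type u} {A : Type v} [CommRing k] [CommRing A]
    [HopfAlgebra k A] (𝒦 : Degree → AddSubgroup k) (𝒜 : Degree → AddSubgroup A) : Prop where
  isGradedAlgebra : IsGradedAlgebra 𝒦 𝒜
  comul_mem : ∀ (γ : Degree) (a : A), a ∈ 𝒜 γ → Coalgebra.comul (R := k) a ∈ tensorGrade k 𝒜 𝒜 γ
  counit_mem : ∀ (γ : Degree) (a : A), a ∈ 𝒜 γ → Coalgebra.counit (R := k) a ∈ 𝒦 γ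
  antipode_mem : ∀ (γ : Degree) (a : A), a ∈ 𝒜 γ → HopfAlgebra.antipode k a ∈ 𝒜 γ

/-! ### The additive group and the algebras of Russell type -/

section Additive

/-- The polynomial algebra `k[T_1, …, T_d]`, regarded as the algebra of functions on the
`d`-dimensional additive group. It is a copy of `MvPolynomial (Fin d) k`: the latter already carries
another coalgebra structure in Mathlib, the one with group-like monomials. -/
def AddGroupAlgebra (k : Type u) [CommRing k] (d : ℕ) : Type u :=
  MvPolynomial (Fin d) k

variable (k : Type u) [CommRing k] (d : ℕ)

instance : CommRing (AddGroupAlgebra k d) :=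
  inferInstanceAs (CommRing (MvPolynomial (Fin d) k))

instance : Algebra k (AddGroupAlgebra k d) :=
  inferInstanceAs (Algebra k (MvPolynomial (Fin d) k))

/-- The identity, as an isomorphism of `k`-algebras. -/
def toAddGroupAlgebra : MvPolynomial (Fin d) k ≃ₐ[k] AddGroupAlgebra k d :=
  AlgEquiv.refl (R := k) (A₁ := MvPolynomial (Fin d) k)

variable {k d}

/-- The coordinate `T_j`. -/
def coord (j : Fin d) : AddGroupAlgebra k d :=
  toAddGroupAlgebra k d (MvPolynomial.X j)

/-- The algebra homomorphism from `k[T_1, …, T_d]` that maps `T_j` to `x j`. -/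
def coordLift {S : Type v} [CommRing S] [Algebra k S] (x : Fin d → S) :
    AddGroupAlgebra k d →ₐ[k] S :=
  (MvPolynomial.aeval x).comp (toAddGroupAlgebra k d).symm.toAlgHom

@[simp]
theorem coordLift_coord {S : Type v} [CommRing S] [Algebra k S] (x : Fin d → S) (j : Fin d) :
    coordLift x (coord j : AddGroupAlgebra k d) = x j := by
  simp [coordLift, coord]

@[ext]
theorem algHom_ext {S : Type v} [Semiring S] [Algebra k S] {f g : AddGroupAlgebra k d →ₐ[k] S}
    (h : ∀ j, f (coord j) = g (coord j)) : f = g := by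
  have : f.comp (toAddGroupAlgebra k d).toAlgHom = g.comp (toAddGroupAlgebra k d).toAlgHom :=
    MvPolynomial.algHom_ext h
  ext x
  exact DFunLike.congr_fun this x

variable (k d)

/-- The bialgebra of functions on the `d`-dimensional additive group, with origin `T = 0`: the
comultiplication maps `T_j` to `T_j ⊗ 1 + 1 ⊗ T_j`, and the counit maps `T_j` to `0`. -/
instance addBialgebra : Bialgebra k (AddGroupAlgebra k d) :=
  .ofAlgHom (coordLift fun j => coord j ⊗ₜ[k] 1 + 1 ⊗ₜ[k] coord j) (coordLift fun _ => 0)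
    (by
      ext j
      simp [Algebra.TensorProduct.one_def, TensorProduct.add_tmul, TensorProduct.tmul_add,
        add_assoc])
    (by ext j; simp)
    (by ext j; simp)

theorem comulAlgHom_eq : Bialgebra.comulAlgHom k (AddGroupAlgebra k d) =
    coordLift fun j => coord j ⊗ₜ[k] 1 + 1 ⊗ₜ[k] coord j :=
  rfl

theorem counitAlgHom_eq : Bialgebra.counitAlgHom k (AddGroupAlgebra k d) =
    coordLift fun _ => 0 :=
  rfl

/-- The Hopf algebra of functions on the `d`-dimensional additive group, with antipode
`T_j ↦ -T_j`. -/
instance addHopfAlgebra : HopfAlgebra k (AddGroupAlgebra k d) :=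
  .ofAlgHom (coordLift fun j => -coord j)
    (by
      ext j
      rw [comulAlgHom_eq, counitAlgHom_eq, AlgHom.comp_apply, coordLift_coord, map_add]
      refine (congrArg₂ (· + ·) (Algebra.TensorProduct.lift_tmul _ _ _ _ _)
        (Algebra.TensorProduct.lift_tmul _ _ _ _ _)).trans ?_
      simp)
    (by ext j; rw [comulAlgHom_eq, counitAlgHom_eq]; simp)

theorem antipode_eq (x : AddGroupAlgebra k d) : HopfAlgebra.antipode k x =
    coordLift (fun j => -coord j : Fin d → AddGroupAlgebra k d) x :=
  rfl

end Additive

section Russell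

variable (p n : ℕ) {k : Type u} [CommRing k] {m : ℕ} (a : Fin (m + 1) → k)

/-- The `p`-polynomial `a₀ T + a₁ T^p + ⋯ + a_m T^{p^m}`. -/
def pPolynomial : Polynomial k :=
  ∑ i : Fin (m + 1), Polynomial.C (a i) * Polynomial.X ^ p ^ (i : ℕ)

/-- A `p`-polynomial is additive in characteristic `p`. -/
theorem aeval_pPolynomial_add [Fact p.Prime] [CharP k p] {S : Type v} [CommRing S] [Algebra k S]
    (x y : S) : Polynomial.aeval (x + y) (pPolynomial p a) =
      Polynomial.aeval x (pPolynomial p a) + Polynomial.aeval y (pPolynomial p a) := by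
  have hp : (p : S) = 0 := by
    rw [← map_natCast (algebraMap k S) p, CharP.cast_eq_zero, map_zero]
  simp only [pPolynomial, map_sum, map_mul, map_pow, Polynomial.aeval_C, Polynomial.aeval_X]
  rw [← Finset.sum_add_distrib]
  refine Finset.sum_congr rfl fun i _ => ?_
  obtain ⟨z, hz⟩ := exists_add_pow_prime_pow_eq (Fact.out : p.Prime) x y i
  rw [hz, hp]
  ring

/-- The element `T₂^{p^n} - f(T₁)`, where `f` is the `p`-polynomial with coefficients `a`. The
coordinates `T₁`, `T₂` are `coord 0`, `coord 1`. -/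
def russellRelation : AddGroupAlgebra k 2 :=
  coord 1 ^ p ^ n - Polynomial.aeval (coord 0) (pPolynomial p a)

/-- The ideal `(T₂^{p^n} - f(T₁))`. -/
def russellIdeal : Ideal (AddGroupAlgebra k 2) :=
  Ideal.span {russellRelation p n a}

theorem map_russellRelation {S : Type v} [CommRing S] [Algebra k S]
    (φ : AddGroupAlgebra k 2 →ₐ[k] S) : φ (russellRelation p n a) =
      φ (coord 1) ^ p ^ n - Polynomial.aeval (φ (coord 0)) (pPolynomial p a) := by
  rw [russellRelation, map_sub, map_pow, Polynomial.aeval_algHom_apply]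

/-- The relation is an additive function of `(T₁, T₂)` in characteristic `p`. -/
theorem map_russellRelation_add [Fact p.Prime] [CharP k p] {S : Type v} [CommRing S] [Algebra k S]
    {φ ψ χ : AddGroupAlgebra k 2 →ₐ[k] S} (h : ∀ j, φ (coord j) = ψ (coord j) + χ (coord j)) :
    φ (russellRelation p n a) = ψ (russellRelation p n a) + χ (russellRelation p n a) := by
  have hp : (p : S) = 0 := by
    rw [← map_natCast (algebraMap k S) p, CharP.cast_eq_zero, map_zero]
  obtain ⟨z, hz⟩ :=
    exists_add_pow_prime_pow_eq (Fact.out : p.Prime) (ψ (coord 1)) (χ (coord 1)) n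
  simp only [map_russellRelation, h, aeval_pPolynomial_add, hz, hp]
  ring

/-- The ideal `(T₂^{p^n} - f(T₁))` is a Hopf ideal, because `f` is additive. -/
instance russellIdeal_isHopfIdeal [Fact p.Prime] [CharP k p] :
    (russellIdeal p n a).IsHopfIdeal k where
  counit_eq_zero := by
    have hz : coordLift (k := k) (d := 2) (fun _ => (0 : k)) (russellRelation p n a) = 0 := by
      have := map_russellRelation_add p n a (φ := coordLift (k := k) (d := 2) (fun _ => (0 : k)))
        (ψ := coordLift fun _ => 0) (χ := coordLift fun _ => 0) (by simp)
      simpa using this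
    intro x hx
    obtain ⟨y, rfl⟩ := Ideal.mem_span_singleton'.mp hx
    change coordLift (k := k) (d := 2) (fun _ => (0 : k)) (y * russellRelation p n a) = 0
    rw [map_mul, hz, mul_zero]
  map_mkQ_comul_eq_zero := by
    let q := Ideal.Quotient.mkₐ k (russellIdeal p n a)
    let Q := (Algebra.TensorProduct.map q q).comp (Bialgebra.comulAlgHom k (AddGroupAlgebra k 2))
    have hq : q (russellRelation p n a) = 0 :=
      Ideal.Quotient.eq_zero_iff_mem.mpr (Ideal.subset_span rfl)
    have hz : Q (russellRelation p n a) = 0 := by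
      have := map_russellRelation_add p n a (φ := Q)
        (ψ := Algebra.TensorProduct.includeLeft.comp q)
        (χ := Algebra.TensorProduct.includeRight.comp q)
        (by intro j; simp [Q, comulAlgHom_eq])
      rw [this]
      simp [hq]
    intro x hx
    obtain ⟨y, rfl⟩ := Ideal.mem_span_singleton'.mp hx
    change Q (y * russellRelation p n a) = 0
    rw [map_mul, hz, mul_zero]
  antipode_mem := by
    let q := Ideal.Quotient.mkₐ k (russellIdeal p n a)
    let Q := q.comp (coordLift (fun j => -coord j : Fin 2 → AddGroupAlgebra k 2))
    have hq : q (russellRelation p n a) = 0 :=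
      Ideal.Quotient.eq_zero_iff_mem.mpr (Ideal.subset_span rfl)
    have h0 : (coordLift fun _ => 0 : AddGroupAlgebra k 2 →ₐ[k] _ ⧸ russellIdeal p n a)
        (russellRelation p n a) = 0 := by
      have := map_russellRelation_add p n a
        (φ := (coordLift fun _ => 0 : AddGroupAlgebra k 2 →ₐ[k] _ ⧸ russellIdeal p n a))
        (ψ := coordLift fun _ => 0) (χ := coordLift fun _ => 0) (by simp)
      simpa using this
    have hz : Q (russellRelation p n a) = 0 := by
      have := map_russellRelation_add p n a (φ := coordLift fun _ => 0) (ψ := q) (χ := Q)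
        (by intro j; simp [Q])
      rw [hq, h0, zero_add] at this
      exact this.symm
    intro x hx
    obtain ⟨y, rfl⟩ := Ideal.mem_span_singleton'.mp hx
    rw [antipode_eq]
    refine Ideal.Quotient.eq_zero_iff_mem.mp ?_
    change Q (y * russellRelation p n a) = 0
    rw [map_mul, hz, mul_zero]

/-- The algebra `k[T₁, T₂]/(T₂^{p^n} - f(T₁))`, with the structure of Hopf algebra inherited from
the two-dimensional additive group (Mathlib's quotient by a Hopf ideal). -/
abbrev RussellAlgebra : Type u :=
  AddGroupAlgebra k 2 ⧸ russellIdeal p n a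

/-- The projection from `k[T₁, T₂]` to `k[T₁, T₂]/(T₂^{p^n} - f(T₁))`. -/
def russellMk : MvPolynomial (Fin 2) k →ₐ[k] RussellAlgebra p n a :=
  (Ideal.Quotient.mkₐ k (russellIdeal p n a)).comp (toAddGroupAlgebra k 2).toAlgHom

/-- The quotient grading of `k[r^{-p^n} T₁, s⁻¹ T₂]/(T₂^{p^n} - f(T₁))`, in which the classes of
`T₁` and `T₂` have degrees `r^{p^n}` and `s`. -/
def russellGrade (𝒦 : Degree → AddSubgroup k) (r s γ : Degree) :
    AddSubgroup (RussellAlgebra p n a) :=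
  (mvPolyGrade 𝒦 ![p ^ n • r, s] γ).map (russellMk p n a).toRingHom.toAddMonoidHom

end Russell

end RussellGraded

end

open RussellGraded

/-! Everything is compared with a polynomial ring over `L = k^{p^{-n}}` and then descended to `k`. A
graded field is a domain because its group of degrees is ordered, and a graded algebra over it is
free on homogeneous elements. Hence `L` is faithfully flat over `k`, and a homogeneous element of `L
⊗ A` has homogeneous coordinates in `A`.

For (1), write `aᵢ = bᵢ^{p^n}` with `bᵢ` in `L`. Sending `T₁` to `X^{p^n}` and `T₂` to `∑ bᵢ
X^{p^i}` defines a graded map from `L ⊗ A` to `L[X]`. An inverse amounts to an element `u` of `L ⊗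
A` with `u^{p^n} = T₁` and `∑ bᵢ u^{p^i} = T₂`. Since `b₀` is invertible, `u` can be extracted one
`p`-th root at a time (`exists_pow_eq_and_sum_eq`, `exists_gradedEquiv_russellAlgebra`). The Hopf
structure and the degrees are checked on the coordinates.

For (2), let `θ : L ⊗ A ≅ L[X]`. Comparing degrees in `X` shows that a polynomial group law on the
line over a domain is `u + v - o` with `o` the unit (`formMul_eq`); a homogeneous translation makes
`o = 0`, so `X` becomes primitive. Expand `θ⁻¹(X) = ∑ βⱼ ⊗ cⱼ` in a homogeneous basis `βⱼ` of `L`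
over `k`. Primitivity is a `k`-linear condition, so every `cⱼ` is primitive, and one of them, `y`,
has nonzero linear coefficient. Moreover `x = ∑ βⱼ^{p^n} cⱼ^{p^n}` lies in `A` and corresponds to
`X^{p^n}`. The polynomial of `y` is additive, hence of the form `∑ bᵢ X^{p^i}`, so `y^{p^n} = ∑
bᵢ^{p^n} x^{p^i}` with `bᵢ^{p^n}` in `k`. The homomorphism given by `(x, y)` becomes over `L` the
composite of two isomorphisms with `L[X]`, so it is bijective by faithful flatness. -/

open RussellGraded
namespace RussellGraded

open DirectSum

universe v

/-! ### Graded rings -/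

section GradedRing

variable {A S : Type*} [CommRing A] [CommRing S] {𝒜 : Degree → AddSubgroup A}
  {𝒮 : Degree → AddSubgroup S}

/-- A multiplicative family of subgroups that span is a grading if the inclusions into some group
`S` are separated by additive projections. -/
theorem nonempty_gradedRing_of_injective {S : Type*} [AddCommGroup S]
    [SetLike.GradedMonoid 𝒜] (hspan : ∀ a, a ∈ AddSubgroup.closure {x | ∃ γ, x ∈ 𝒜 γ})
    (φ : A →+ S) (hφ : Function.Injective φ) (P : Degree → S →+ S)
    (hsame : ∀ γ, ∀ x ∈ 𝒜 γ, P γ (φ x) = φ x)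
    (hne : ∀ γ δ, γ ≠ δ → ∀ x ∈ 𝒜 γ, P δ (φ x) = 0) : Nonempty (GradedRing 𝒜) := by
  have key : ∀ (δ : Degree) (x : ⨁ i, 𝒜 i), P δ (φ (DirectSum.coeAddMonoidHom 𝒜 x)) = φ (x δ) := by
    intro δ x
    induction x using DirectSum.induction_on with
    | zero => simp
    | of i x =>
      rw [DirectSum.coeAddMonoidHom_of]
      rcases eq_or_ne i δ with rfl | h
      · rw [hsame _ _ x.2, DirectSum.of_eq_same]
      · rw [hne _ _ h _ x.2, DirectSum.of_eq_of_ne _ _ _ h.symm, ZeroMemClass.coe_zero, map_zero]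
    | add x y hx hy => simp only [map_add, hx, hy, DirectSum.add_apply, AddMemClass.coe_add]
  have hint : DirectSum.IsInternal 𝒜 := by
    refine ⟨(injective_iff_map_eq_zero _).mpr fun x hx => ?_, fun a => ?_⟩
    · refine DFinsupp.ext fun δ => Subtype.ext (hφ ?_)
      rw [← key, hx]
      simp
    · change a ∈ (DirectSum.coeAddMonoidHom 𝒜).range
      refine (AddSubgroup.closure_le _).mpr ?_ (hspan a)
      rintro x ⟨γ, hx⟩
      exact ⟨DirectSum.of (fun i => 𝒜 i) γ ⟨x, hx⟩, DirectSum.coeAddMonoidHom_of ..⟩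
  exact ⟨{ hint.chooseDecomposition with }⟩

theorem mem_closure_homogeneous [GradedRing 𝒜] (a : A) :
    a ∈ AddSubgroup.closure {x | ∃ γ, x ∈ 𝒜 γ} := by
  classical
  rw [← DirectSum.sum_support_decompose 𝒜 a]
  exact sum_mem fun i _ => AddSubgroup.subset_closure ⟨i, (decompose 𝒜 a i).2⟩

theorem map_decompose_of_graded [GradedRing 𝒜] [GradedRing 𝒮] (φ : A →+ S)
    (hφ : ∀ γ, ∀ x ∈ 𝒜 γ, φ x ∈ 𝒮 γ) (δ : Degree) (x : A) :
    φ (decompose 𝒜 x δ) = decompose 𝒮 (φ x) δ := by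
  induction x using DirectSum.Decomposition.inductionOn 𝒜 with
  | zero => simp
  | @homogeneous i m =>
    rcases eq_or_ne i δ with rfl | h
    · rw [decompose_of_mem_same 𝒜 m.2, decompose_of_mem_same 𝒮 (hφ _ _ m.2)]
    · rw [decompose_of_mem_ne 𝒜 m.2 h, decompose_of_mem_ne 𝒮 (hφ _ _ m.2) h, map_zero]
  | add x y hx hy => simp only [decompose_add, map_add, DirectSum.add_apply, AddMemClass.coe_add,
      hx, hy]

/-- The kernel of a graded map contains the components of each of its elements. -/
theorem injective_of_graded [GradedRing 𝒜] [GradedRing 𝒮] (φ : A →+ S)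
    (hφ : ∀ γ, ∀ x ∈ 𝒜 γ, φ x ∈ 𝒮 γ) (h0 : ∀ γ, ∀ x ∈ 𝒜 γ, φ x = 0 → x = 0) :
    Function.Injective φ := by
  classical
  refine (injective_iff_map_eq_zero _).mpr fun x hx => ?_
  rw [← DirectSum.sum_support_decompose 𝒜 x]
  refine Finset.sum_eq_zero fun i _ => h0 i _ (decompose 𝒜 x i).2 ?_
  rw [map_decompose_of_graded φ hφ, hx]
  simp

theorem mem_of_map_mem [GradedRing 𝒜] [GradedRing 𝒮] (φ : A →+ S)
    (hφ : ∀ γ, ∀ x ∈ 𝒜 γ, φ x ∈ 𝒮 γ) (hinj : Function.Injective φ) {γ : Degree} {x : A}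
    (hx : φ x ∈ 𝒮 γ) : x ∈ 𝒜 γ := by
  have : φ (decompose 𝒜 x γ) = φ x := by
    rw [map_decompose_of_graded φ hφ, decompose_of_mem_same 𝒮 hx]
  rw [← hinj this]
  exact (decompose 𝒜 x γ).2

/-- The zero ideal is homogeneous, and over an ordered group of degrees primality of such an ideal
can be tested on homogeneous elements. -/
theorem isDomain_of_isUnit_homogeneous {ι : Type*} [AddCommMonoid ι] [LinearOrder ι]
    [IsOrderedCancelAddMonoid ι] {𝒜 : ι → AddSubgroup A} [GradedRing 𝒜] [Nontrivial A]
    (hA : ∀ γ, ∀ x ∈ 𝒜 γ, x ≠ 0 → IsUnit x) : IsDomain A := by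
  have : (⊥ : Ideal A).IsPrime := by
    refine Ideal.IsHomogeneous.isPrime_of_homogeneous_mem_or_mem (𝒜 := 𝒜)
      (Ideal.IsHomogeneous.bot 𝒜) bot_ne_top ?_
    rintro x y ⟨γ, hx⟩ - h
    rw [Ideal.mem_bot] at h ⊢
    rw [Ideal.mem_bot]
    by_contra! hxy
    exact hxy.2 ((hA γ x hx hxy.1).mul_right_eq_zero.mp h)
  exact IsDomain.of_bot_isPrime A

/-- A graded field is an integral domain, as the group of degrees is ordered. -/
theorem IsGradedField.isDomain (hA : IsGradedField 𝒜) : IsDomain A := by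
  obtain ⟨i⟩ := hA.graded
  have hnt := hA.nontrivial
  -- A `GradedRing` structure carries a decidable equality on the degrees; it is moved to the one
  -- that comes from the linear order.
  have h : ∀ d : DecidableEq Degree, d = (fun a b => instDecidableEqAdditive a b) →
      Nonempty (GradedRing 𝒜) := by
    rintro _ rfl
    exact ⟨i⟩
  obtain ⟨j⟩ := h LinearOrder.toDecidableEq (Subsingleton.elim _ _)
  exact isDomain_of_isUnit_homogeneous hA.isUnit_of_ne_zero

/-- A nonzero homogeneous element is a unit, so its image in a nonzero ring is nonzero. -/
theorem IsGradedField.algebraMap_injective {k : Type*} [CommRing k] {𝒦 : Degree → AddSubgroup k}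
    (hk : IsGradedField 𝒦) [Algebra k A] [Nontrivial A] (hA : IsGradedAlgebra 𝒦 𝒜) :
    Function.Injective (algebraMap k A) := by
  obtain ⟨_⟩ := hk.graded
  obtain ⟨_⟩ := hA.graded
  refine injective_of_graded (𝒜 := 𝒦) (𝒮 := 𝒜) (algebraMap k A).toAddMonoidHom
    hA.algebraMap_mem fun γ x hx h0 => ?_
  by_contra hne
  exact ((hk.isUnit_of_ne_zero γ x hx hne).map (algebraMap k A)).ne_zero h0

theorem IsGradedAlgebra.smul_mem {k : Type*} [CommRing k] {𝒦 : Degree → AddSubgroup k}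
    [Algebra k A] (hA : IsGradedAlgebra 𝒦 𝒜) {γ δ : Degree} {c : k} {x : A} (hc : c ∈ 𝒦 γ)
    (hx : x ∈ 𝒜 δ) : c • x ∈ 𝒜 (γ + δ) := by
  obtain ⟨_⟩ := hA.graded
  rw [Algebra.smul_def]
  exact SetLike.mul_mem_graded (hA.algebraMap_mem _ _ hc) hx

theorem IsGradedAlgebra.decompose_smul_add {k : Type*} [CommRing k] {𝒦 : Degree → AddSubgroup k}
    [Algebra k A] [GradedRing 𝒦] [GradedRing 𝒜] (hA : IsGradedAlgebra 𝒦 𝒜) {δ : Degree} (c : k)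
    {x : A} (hx : x ∈ 𝒜 δ) (γ : Degree) :
    (decompose 𝒜 (c • x) γ : A) = (decompose 𝒦 c (γ - δ) : k) • x := by
  conv_lhs => rw [← sub_add_cancel γ δ]
  rw [Algebra.smul_def, coe_decompose_mul_add_of_right_mem 𝒜 hx, Algebra.smul_def]
  exact congrArg (· * x) (map_decompose_of_graded (𝒜 := 𝒦) (𝒮 := 𝒜)
    (algebraMap k A).toAddMonoidHom hA.algebraMap_mem _ _).symm

/-- A graded algebra over a graded field is free, with a basis of homogeneous elements. -/
theorem exists_homogeneous_basis {k : Type*} [CommRing k] {𝒦 : Degree → AddSubgroup k}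
    {A : Type v} [CommRing A] {𝒜 : Degree → AddSubgroup A} (hk : IsGradedField 𝒦) [Algebra k A] (hA : IsGradedAlgebra 𝒦 𝒜) :
    ∃ (ι : Type v) (b : Module.Basis ι k A) (d : ι → Degree),
      (∀ j, b j ∈ 𝒜 (d j)) ∧ ∀ γ, ∀ x ∈ 𝒜 γ, ∀ j, b.repr x j ∈ 𝒦 (γ - d j) := by
  classical
  have := hk.isDomain
  obtain ⟨_⟩ := hk.graded
  obtain ⟨_⟩ := hA.graded
  let v : {x : A // ∃ γ, x ∈ 𝒜 γ} → A := Subtype.val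
  -- The basis is a maximal linearly independent family of homogeneous elements.
  obtain ⟨s, hs, hmax⟩ := exists_maximal_linearIndepOn k v
  choose d hd using fun j : {x : A // ∃ γ, x ∈ 𝒜 γ} => j.2
  have hspan : ∀ x : {x : A // ∃ γ, x ∈ 𝒜 γ}, (x : A) ∈ Submodule.span k (v '' s) := by
    intro x
    by_cases hx : x ∈ s
    · exact Submodule.subset_span ⟨x, hx, rfl⟩
    -- Maximality only gives `c • x` in the span for some `c ≠ 0`. The span is stable under taking
    -- components, so `c` may be replaced by a nonzero homogeneous component, which is invertible.
    obtain ⟨c, hc, hcx⟩ := hmax x hx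
    have hhom : ∀ y ∈ Submodule.span k (v '' s), ∀ γ,
        (decompose 𝒜 y γ : A) ∈ Submodule.span k (v '' s) := by
      intro y hy γ
      induction hy using Submodule.closure_induction with
      | zero => simp
      | add y z _ _ hy hz => simpa using add_mem hy hz
      | smul_mem c y hy =>
        obtain ⟨z, hz, rfl⟩ := hy
        rw [hA.decompose_smul_add c (hd z)]
        exact Submodule.smul_mem _ _ (Submodule.subset_span ⟨z, hz, rfl⟩)
    obtain ⟨δ, hδ⟩ : ∃ δ, (decompose 𝒦 c δ : k) ≠ 0 := by
      by_contra! h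
      refine hc ?_
      rw [← DirectSum.sum_support_decompose 𝒦 c]
      exact Finset.sum_eq_zero fun i _ => h i
    have := hhom _ hcx (δ + d x)
    rw [hA.decompose_smul_add c (hd x), add_sub_cancel_right] at this
    exact (Submodule.smul_mem_iff_of_isUnit _
      (hk.isUnit_of_ne_zero δ _ (decompose 𝒦 c δ).2 hδ)).mp this
  have htop : ⊤ ≤ Submodule.span k (Set.range fun j : s => v j) := by
    intro x _
    have h : v '' s = Set.range fun j : s => v j := by
      rw [Set.image_eq_range]
    rw [← DirectSum.sum_support_decompose 𝒜 x, ← h]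
    exact sum_mem fun i _ => hspan ⟨_, i, (decompose 𝒜 x i).2⟩
  let b := Module.Basis.mk hs htop
  have hb : ∀ j, b j = v j := fun j => Module.Basis.mk_apply hs htop j
  refine ⟨s, b, fun j => d j, fun j => show b j ∈ 𝒜 (d j) by rw [hb]; exact hd j, fun γ x hx j => ?_⟩
  -- The degree `γ` component of the expansion of `x` is again an expansion of `x`, now with
  -- homogeneous coefficients.
  have hx' : x = ∑ i ∈ (b.repr x).support, (decompose 𝒦 (b.repr x i) (γ - d i) : k) • b i := by
    conv_lhs => rw [← decompose_of_mem_same 𝒜 hx, ← b.linearCombination_repr x,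
      Finsupp.linearCombination_apply, Finsupp.sum, DirectSum.decompose_sum, DFinsupp.finsetSum_apply,
      AddSubmonoidClass.coe_finsetSum]
    refine Finset.sum_congr rfl fun i _ => ?_
    rw [hA.decompose_smul_add _ (show b i ∈ 𝒜 (d i) by rw [hb]; exact hd i)]
  rw [hx']
  simp only [map_sum, map_smul, Module.Basis.repr_self, Finsupp.finsetSum_apply, Finsupp.smul_apply,
    Finsupp.single_apply, smul_eq_mul, mul_ite, mul_one, mul_zero]
  rw [Finset.sum_ite_eq']
  split_ifs
  · exact (decompose 𝒦 _ _).2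
  · exact zero_mem _

end GradedRing

end RussellGraded

namespace RussellGraded

/-! ### Gradings of polynomial rings and tensor products -/

section PolyGrade

variable {A S : Type*} [CommRing A] [CommRing S] {𝒜 : Degree → AddSubgroup A}
  {𝒮 : Degree → AddSubgroup S}

instance polyGrade_gradedMonoid [SetLike.GradedMonoid 𝒜] (r : Degree) :
    SetLike.GradedMonoid (polyGrade 𝒜 r) where
  one_mem i := by
    rw [Polynomial.coeff_one]
    split_ifs with h
    · subst h
      simpa using SetLike.GradedOne.one_mem (A := 𝒜)
    · exact zero_mem _
  mul_mem γ δ f g hf hg i := by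
    rw [Polynomial.coeff_mul]
    refine sum_mem fun x hx => ?_
    have := SetLike.mul_mem_graded (hf x.1) (hg x.2)
    rwa [sub_add_sub_comm, ← add_smul, Finset.HasAntidiagonal.mem_antidiagonal.mp hx] at this

instance mvPolyGrade_gradedMonoid [SetLike.GradedMonoid 𝒜] {d : ℕ} (r : Fin d → Degree) :
    SetLike.GradedMonoid (mvPolyGrade 𝒜 r) where
  one_mem I := by
    classical
    rw [MvPolynomial.coeff_one]
    split_ifs with h
    · subst h
      simpa using SetLike.GradedOne.one_mem (A := 𝒜)
    · exact zero_mem _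
  mul_mem γ δ f g hf hg I := by
    classical
    rw [MvPolynomial.coeff_mul]
    refine sum_mem fun x hx => ?_
    have := SetLike.mul_mem_graded (hf x.1) (hg x.2)
    rw [sub_add_sub_comm, ← Finset.sum_add_distrib] at this
    rw [← Finset.HasAntidiagonal.mem_antidiagonal.mp hx]
    simpa only [← add_smul, Finsupp.add_apply] using this

theorem C_mem_polyGrade {r γ : Degree} {c : A} (hc : c ∈ 𝒜 γ) :
    Polynomial.C c ∈ polyGrade 𝒜 r γ := by
  intro i
  rw [Polynomial.coeff_C]
  split_ifs with h
  · subst h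
    simpa using hc
  · exact zero_mem _

theorem X_mem_polyGrade [SetLike.GradedMonoid 𝒜] (r : Degree) :
    Polynomial.X ∈ polyGrade 𝒜 r r := by
  intro i
  rw [Polynomial.coeff_X]
  split_ifs with h
  · subst h
    simpa using SetLike.GradedOne.one_mem (A := 𝒜)
  · exact zero_mem _

theorem eval₂_mem_of_mem_polyGrade [SetLike.GradedMonoid 𝒮] (φ : A →+* S)
    (hφ : ∀ γ, ∀ x ∈ 𝒜 γ, φ x ∈ 𝒮 γ) {r γ : Degree} {x : S} (hx : x ∈ 𝒮 r) {f : Polynomial A}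
    (hf : f ∈ polyGrade 𝒜 r γ) : f.eval₂ φ x ∈ 𝒮 γ := by
  rw [Polynomial.eval₂_eq_sum_range]
  refine sum_mem fun i _ => ?_
  have := SetLike.mul_mem_graded (hφ _ _ (hf i)) (SetLike.pow_mem_graded i hx)
  rwa [sub_add_cancel] at this

theorem eval₂_mem_of_mem_mvPolyGrade [SetLike.GradedMonoid 𝒮] (φ : A →+* S)
    (hφ : ∀ γ, ∀ x ∈ 𝒜 γ, φ x ∈ 𝒮 γ) {d : ℕ} {r : Fin d → Degree} {γ : Degree} {x : Fin d → S}
    (hx : ∀ j, x j ∈ 𝒮 (r j)) {f : MvPolynomial (Fin d) A} (hf : f ∈ mvPolyGrade 𝒜 r γ) :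
    f.eval₂ φ x ∈ 𝒮 γ := by
  rw [MvPolynomial.eval₂_eq']
  refine sum_mem fun I _ => ?_
  have := SetLike.mul_mem_graded (hφ _ _ (hf I)) (SetLike.prod_pow_mem_graded 𝒮 r x
    (F := Finset.univ) I fun j _ => hx j)
  rwa [sub_add_cancel] at this

theorem X_mem_mvPolyGrade [SetLike.GradedMonoid 𝒜] {d : ℕ} (r : Fin d → Degree) (j : Fin d) :
    MvPolynomial.X j ∈ mvPolyGrade 𝒜 r (r j) := by
  classical
  intro I
  rw [MvPolynomial.coeff_X]
  split_ifs with h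
  · subst h
    simpa [Finsupp.single_apply, ite_smul] using SetLike.GradedOne.one_mem (A := 𝒜)
  · exact zero_mem _

theorem mvPolyGrade_mem_closure [GradedRing 𝒜] {d : ℕ} (r : Fin d → Degree)
    (f : MvPolynomial (Fin d) A) :
    f ∈ AddSubgroup.closure {x | ∃ γ, x ∈ mvPolyGrade 𝒜 r γ} := by
  classical
  induction f using MvPolynomial.induction_on' with
  | monomial I c =>
    induction mem_closure_homogeneous (𝒜 := 𝒜) c using AddSubgroup.closure_induction with
    | zero => simp
    | add a b _ _ ha hb => simpa using add_mem ha hb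
    | neg a _ ha => simpa using neg_mem ha
    | mem a ha =>
      obtain ⟨γ, hγ⟩ := ha
      refine AddSubgroup.subset_closure ⟨γ + ∑ j, I j • r j, fun J => ?_⟩
      rw [MvPolynomial.coeff_monomial]
      split_ifs with h
      · subst h
        simpa using hγ
      · exact zero_mem _
  | add f g hf hg => exact add_mem hf hg

end PolyGrade

section TensorGrade

variable {R M N S : Type*} [CommRing R] [CommRing M] [CommRing N] [Algebra R M] [Algebra R N]
  [CommRing S] {ℳ : Degree → AddSubgroup M} {𝒩 : Degree → AddSubgroup N}
  {𝒮 : Degree → AddSubgroup S}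

theorem tmul_mem_tensorGrade {δ τ : Degree} {x : M} {y : N} (hx : x ∈ ℳ δ) (hy : y ∈ 𝒩 τ) :
    x ⊗ₜ[R] y ∈ tensorGrade R ℳ 𝒩 (δ + τ) :=
  AddSubgroup.subset_closure ⟨δ, τ, rfl, x, hx, y, hy, rfl⟩

theorem map_mem_of_mem_tensorGrade {G : Type*} [AddCommGroup G] {𝒢 : Degree → AddSubgroup G}
    (f : M ⊗[R] N →+ G) (hf : ∀ δ τ, ∀ x ∈ ℳ δ, ∀ y ∈ 𝒩 τ, f (x ⊗ₜ y) ∈ 𝒢 (δ + τ))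
    {γ : Degree} {z : M ⊗[R] N} (hz : z ∈ tensorGrade R ℳ 𝒩 γ) : f z ∈ 𝒢 γ := by
  have : tensorGrade R ℳ 𝒩 γ ≤ (𝒢 γ).comap f := by
    refine (AddSubgroup.closure_le _).mpr ?_
    rintro _ ⟨δ, τ, rfl, x, hx, y, hy, rfl⟩
    exact hf δ τ x hx y hy
  exact this hz

instance tensorGrade_gradedMonoid [SetLike.GradedMonoid ℳ] [SetLike.GradedMonoid 𝒩] :
    SetLike.GradedMonoid (tensorGrade R ℳ 𝒩) where
  one_mem := by
    have := tmul_mem_tensorGrade (R := R) (SetLike.GradedOne.one_mem (A := ℳ))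
      (SetLike.GradedOne.one_mem (A := 𝒩))
    rwa [add_zero] at this
  mul_mem γ δ z w hz hw := by
    refine map_mem_of_mem_tensorGrade (ℳ := ℳ) (𝒩 := 𝒩)
      (𝒢 := fun γ => tensorGrade R ℳ 𝒩 (γ + δ)) (AddMonoidHom.mulRight w) (fun a b x hx y hy => ?_) hz
    refine map_mem_of_mem_tensorGrade (ℳ := ℳ) (𝒩 := 𝒩)
      (𝒢 := fun δ => tensorGrade R ℳ 𝒩 (a + b + δ)) (AddMonoidHom.mulLeft (x ⊗ₜ y))
      (fun a' b' x' hx' y' hy' => ?_) hw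
    rw [AddMonoidHom.coe_mulLeft, Algebra.TensorProduct.tmul_mul_tmul, add_add_add_comm]
    exact tmul_mem_tensorGrade (SetLike.mul_mem_graded hx hx') (SetLike.mul_mem_graded hy hy')

/-- The base change of the polynomial ring is the polynomial ring, as a graded algebra. -/
theorem polyEquivTensor'_symm_mem_polyGrade_iff [SetLike.GradedMonoid ℳ] {ℛ : Degree → AddSubgroup R}
    [SetLike.GradedMonoid ℛ] (hM : ∀ γ, ∀ x ∈ ℛ γ, algebraMap R M x ∈ ℳ γ) (r γ : Degree)
    (z : M ⊗[R] Polynomial R) : (polyEquivTensor' R M).symm z ∈ polyGrade ℳ r γ ↔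
      z ∈ tensorGrade R ℳ (polyGrade ℛ r) γ := by
  constructor
  · intro hz
    rw [← (polyEquivTensor' R M).apply_symm_apply z]
    refine eval₂_mem_of_mem_polyGrade (𝒜 := ℳ) _ (fun γ x hx => ?_) ?_ hz
    · have := tmul_mem_tensorGrade (R := R) hx (SetLike.GradedOne.one_mem (A := polyGrade ℛ r))
      rwa [add_zero] at this
    · have := tmul_mem_tensorGrade (R := R) (SetLike.GradedOne.one_mem (A := ℳ))
        (X_mem_polyGrade (𝒜 := ℛ) r)
      rwa [zero_add] at this
  · intro hz
    refine map_mem_of_mem_tensorGrade (ℳ := ℳ) (𝒩 := polyGrade ℛ r) (𝒢 := polyGrade ℳ r)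
      (polyEquivTensor' R M).symm.toAlgHom.toRingHom.toAddMonoidHom (fun δ τ x hx f hf => ?_) hz
    change x • f.map (algebraMap R M) ∈ _
    rw [Polynomial.smul_eq_C_mul]
    exact SetLike.mul_mem_graded (C_mem_polyGrade hx) fun i => by
      rw [Polynomial.coeff_map]; exact hM _ _ (hf i)

/-- Extracting the coordinate along `b j` lowers the degree by `d j` on pure tensors, hence on the
whole tensor product. This is how homogeneous elements of `A` are obtained from a homogeneous
element of `L ⊗ A`. -/
theorem exists_sum_tmul_of_mem_tensorGrade {ι : Type*} (b : Module.Basis ι R M) (d : ι → Degree)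
    {ℛ : Degree → AddSubgroup R} (hN : IsGradedAlgebra ℛ 𝒩)
    (hb : ∀ γ, ∀ x ∈ ℳ γ, ∀ j, b.repr x j ∈ ℛ (γ - d j)) {γ : Degree} {z : M ⊗[R] N}
    (hz : z ∈ tensorGrade R ℳ 𝒩 γ) :
    ∃ c : ι →₀ N, (∀ j, c j ∈ 𝒩 (γ - d j)) ∧ z = c.sum fun j y => b j ⊗ₜ[R] y := by
  classical
  refine ⟨TensorProduct.equivFinsuppOfBasisLeft b z, fun j => ?_, ?_⟩
  · refine map_mem_of_mem_tensorGrade (𝒢 := fun γ => 𝒩 (γ - d j))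
      ((Finsupp.applyAddHom j).comp
        (TensorProduct.equivFinsuppOfBasisLeft (N := N) b).toLinearMap.toAddMonoidHom)
      (fun δ τ x hx y hy => ?_) hz
    have : b.repr x j • y ∈ 𝒩 (δ - d j + τ) := hN.smul_mem (hb δ x hx j) hy
    rw [sub_add_eq_add_sub] at this
    simpa using this
  · rw [← TensorProduct.equivFinsuppOfBasisLeft_symm_apply, LinearEquiv.symm_apply_apply]

end TensorGrade

end RussellGraded

namespace RussellGraded

/-! ### The algebras of Russell type -/

/-- The equations `u ^ p ^ n = x` and `∑ bᵢ u ^ p ^ i = y` can be solved if the compatibility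
`y ^ p ^ n = ∑ bᵢ ^ p ^ n x ^ p ^ i` holds and `b₀` is invertible. -/
theorem exists_pow_eq_and_sum_eq {S : Type*} [CommRing S] {𝒮 : Degree → AddSubgroup S}
    [SetLike.GradedMonoid 𝒮] (p : ℕ) [Fact p.Prime] [CharP S p] {m : ℕ} (n : ℕ) {r s : Degree}
    (b : Fin (m + 1) → S) (hb : ∀ i : Fin (m + 1), b i ∈ 𝒮 (s - p ^ (i : ℕ) • r)) (c : S) (hc : c ∈ 𝒮 (r - s))
    (hcb : c * b 0 = 1) (x y : S) (hx : x ∈ 𝒮 (p ^ n • r)) (hy : y ∈ 𝒮 s)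
    (h : y ^ p ^ n = ∑ i, b i ^ p ^ n * x ^ p ^ (i : ℕ)) :
    ∃ u ∈ 𝒮 r, u ^ p ^ n = x ∧ ∑ i, b i * u ^ p ^ (i : ℕ) = y := by
  induction n generalizing b c x y r s with
  | zero => exact ⟨x, by simpa using hx, by simp, by simpa using h.symm⟩
  | succ n ih =>
    -- The induction hypothesis is applied to `bᵢ^p`, `x`, `y^p`; its solution `u'` is the `p`-th
    -- power of the desired `u`.
    obtain ⟨u', hu', hux, huy⟩ := ih (r := p • r) (s := p • s) (fun i => b i ^ p)
      (fun i => by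
        have := SetLike.pow_mem_graded p (hb i)
        rwa [nsmul_sub, smul_comm] at this) (c ^ p)
      (by
        have := SetLike.pow_mem_graded p hc
        rwa [nsmul_sub] at this)
      (by rw [← mul_pow, hcb, one_pow]) x (y ^ p)
      (by rwa [smul_smul, ← pow_succ]) (SetLike.pow_mem_graded p hy)
      (by simpa only [← pow_mul, ← pow_succ'] using h)
    -- With `u' = u^p`, the equation `∑ bᵢ u^{p^i} = y` reads `b₀ u + w = y`, which forces `u = c (y
    -- - w)`.
    let w := ∑ i : Fin m, b i.succ * u' ^ p ^ (i : ℕ)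
    have hu : (c * (y - w)) ^ p = u' := by
      have hw : w ^ p = ∑ i : Fin m, b i.succ ^ p * u' ^ p ^ ((i : ℕ) + 1) := by
        rw [sum_pow_char]
        refine Finset.sum_congr rfl fun i _ => ?_
        rw [mul_pow, ← pow_mul, pow_succ]
      rw [Fin.sum_univ_succ] at huy
      simp only [Fin.val_zero, pow_zero, pow_one, Fin.val_succ] at huy
      rw [mul_pow, sub_pow_char, hw, ← huy, add_sub_cancel_right, ← mul_assoc, ← mul_pow, hcb,
        one_pow, one_mul]
    refine ⟨c * (y - w), ?_, ?_, ?_⟩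
    · have hw : w ∈ 𝒮 s := sum_mem fun i _ => by
        have := SetLike.mul_mem_graded (hb i.succ) (SetLike.pow_mem_graded (p ^ (i : ℕ)) hu')
        rwa [smul_smul, ← pow_succ, Fin.val_succ, sub_add_cancel] at this
      have := SetLike.mul_mem_graded hc (sub_mem hy hw)
      rwa [sub_add_cancel] at this
    · rw [pow_succ', pow_mul, hu, hux]
    · rw [Fin.sum_univ_succ]
      simp only [Fin.val_zero, pow_zero, pow_one, Fin.val_succ, pow_succ' p, pow_mul, hu]
      rw [← mul_assoc, mul_comm (b 0), hcb, one_mul]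
      exact sub_add_cancel y w

section Russell

variable (p n : ℕ) {k : Type*} [CommRing k] {m : ℕ} (a : Fin (m + 1) → k)
  {S : Type*} [CommRing S] [Algebra k S]

theorem aeval_pPolynomial (x : S) : Polynomial.aeval x (pPolynomial p a) =
    ∑ i, algebraMap k S (a i) * x ^ p ^ (i : ℕ) := by
  simp [pPolynomial]

/-- The classes of the coordinates `T₁` and `T₂`. -/
noncomputable def russellCoord (j : Fin 2) : RussellAlgebra p n a :=
  russellMk p n a (MvPolynomial.X j)

theorem russellCoord_one_pow : russellCoord p n a 1 ^ p ^ n =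
    Polynomial.aeval (russellCoord p n a 0) (pPolynomial p a) := by
  refine sub_eq_zero.mp ((map_russellRelation p n a
    (Ideal.Quotient.mkₐ k (russellIdeal p n a))).symm.trans ?_)
  exact Ideal.Quotient.eq_zero_iff_mem.mpr (Ideal.subset_span rfl)

variable {p n a}

@[ext]
theorem russellAlgebra_algHom_ext {S : Type*} [Semiring S] [Algebra k S]
    {φ ψ : RussellAlgebra p n a →ₐ[k] S}
    (h : ∀ j, φ (russellCoord p n a j) = ψ (russellCoord p n a j)) : φ = ψ :=
  Ideal.Quotient.algHom_ext k (algHom_ext h)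

/-- The algebra homomorphism from `k[T₁, T₂]/(T₂^{p^n} - f(T₁))` that maps `T₁` and `T₂` to a
solution of the equation. -/
noncomputable def russellLift (x y : S) (h : y ^ p ^ n = Polynomial.aeval x (pPolynomial p a)) :
    RussellAlgebra p n a →ₐ[k] S :=
  Ideal.Quotient.liftₐ (russellIdeal p n a) (coordLift ![x, y]) fun z hz => by
    obtain ⟨w, rfl⟩ := Ideal.mem_span_singleton'.mp hz
    rw [map_mul, map_russellRelation]
    simp [h]

theorem russellLift_zero (x y : S) (h : y ^ p ^ n = Polynomial.aeval x (pPolynomial p a)) :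
    russellLift x y h (russellCoord p n a 0) = x :=
  (coordLift_coord (k := k) ![x, y] 0 :)

theorem russellLift_one (x y : S) (h : y ^ p ^ n = Polynomial.aeval x (pPolynomial p a)) :
    russellLift x y h (russellCoord p n a 1) = y :=
  (coordLift_coord (k := k) ![x, y] 1 :)

variable {𝒦 : Degree → AddSubgroup k} {𝒮 : Degree → AddSubgroup S}

instance russellGrade_gradedMonoid [SetLike.GradedMonoid 𝒦] (r s : Degree) :
    SetLike.GradedMonoid (russellGrade p n a 𝒦 r s) where
  one_mem := ⟨1, SetLike.GradedOne.one_mem (A := mvPolyGrade 𝒦 ![p ^ n • r, s]), map_one (russellMk p n a)⟩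
  mul_mem := by
    rintro γ δ _ _ ⟨x, hx, rfl⟩ ⟨y, hy, rfl⟩
    exact ⟨x * y, SetLike.mul_mem_graded hx hy, map_mul (russellMk p n a) _ _⟩

theorem russellCoord_mem [SetLike.GradedMonoid 𝒦] (r s : Degree) (j : Fin 2) :
    russellCoord p n a j ∈ russellGrade p n a 𝒦 r s (![p ^ n • r, s] j) :=
  ⟨MvPolynomial.X j, X_mem_mvPolyGrade _ j, rfl⟩

theorem algebraMap_mem_russellGrade (r s : Degree) {γ : Degree} {c : k} (hc : c ∈ 𝒦 γ) :
    algebraMap k (RussellAlgebra p n a) c ∈ russellGrade p n a 𝒦 r s γ := by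
  classical
  refine ⟨MvPolynomial.C c, fun I => ?_, (russellMk p n a).commutes c⟩
  rw [MvPolynomial.coeff_C]
  split_ifs with h
  · subst h
    simpa using hc
  · exact zero_mem _

theorem russellGrade_mem_closure [GradedRing 𝒦] (r s : Degree) (z : RussellAlgebra p n a) :
    z ∈ AddSubgroup.closure {x | ∃ γ, x ∈ russellGrade p n a 𝒦 r s γ} := by
  obtain ⟨f, rfl⟩ : ∃ f, russellMk p n a f = z := Ideal.Quotient.mk_surjective z
  induction mvPolyGrade_mem_closure (𝒜 := 𝒦) ![p ^ n • r, s] f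
    using AddSubgroup.closure_induction with
  | zero => simp
  | add a b _ _ ha hb => simpa using add_mem ha hb
  | neg a _ ha => simpa using neg_mem ha
  | mem f hf =>
    obtain ⟨γ, hγ⟩ := hf
    exact AddSubgroup.subset_closure ⟨γ, f, hγ, rfl⟩

theorem map_mem_of_mem_russellGrade [SetLike.GradedMonoid 𝒮]
    (hS : ∀ γ, ∀ x ∈ 𝒦 γ, algebraMap k S x ∈ 𝒮 γ) {r s : Degree}
    (φ : RussellAlgebra p n a →ₐ[k] S) (h0 : φ (russellCoord p n a 0) ∈ 𝒮 (p ^ n • r))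
    (h1 : φ (russellCoord p n a 1) ∈ 𝒮 s) {γ : Degree} {z : RussellAlgebra p n a}
    (hz : z ∈ russellGrade p n a 𝒦 r s γ) : φ z ∈ 𝒮 γ := by
  obtain ⟨f, hf, rfl⟩ := hz
  have : φ.comp (russellMk p n a) =
      MvPolynomial.aeval fun j => φ (russellCoord p n a j) := by
    ext j
    simp [russellCoord]
  refine (congrArg (· ∈ 𝒮 γ) (DFunLike.congr_fun this f)).mpr ?_
  refine eval₂_mem_of_mem_mvPolyGrade (𝒜 := 𝒦) (algebraMap k S) hS (fun j => ?_) hf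
  fin_cases j
  · exact h0
  · exact h1

/-- Over a ring `L` that contains the coefficients `bᵢ = aᵢ^{p^{-n}}`, the algebra
`k[T₁, T₂]/(T₂^{p^n} - f(T₁))` becomes a polynomial ring. -/
theorem exists_gradedEquiv_russellAlgebra [Fact p.Prime] {L : Type*} [CommRing L] [IsDomain L]
    [CharP L p] [Algebra k L] {ℒ : Degree → AddSubgroup L} [SetLike.GradedMonoid 𝒦]
    [SetLike.GradedMonoid ℒ] (hL : ∀ γ, ∀ x ∈ 𝒦 γ, algebraMap k L x ∈ ℒ γ) {r s : Degree}
    (b : Fin (m + 1) → L) (hab : ∀ i, algebraMap k L (a i) = b i ^ p ^ n)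
    (hb : ∀ i : Fin (m + 1), b i ∈ ℒ (s - p ^ (i : ℕ) • r)) {c : L} (hc : c ∈ ℒ (r - s)) (hcb : c * b 0 = 1) :
    ∃ Θ : (L ⊗[k] RussellAlgebra p n a) ≃ₐ[L] Polynomial L,
      Θ (1 ⊗ₜ russellCoord p n a 0) = Polynomial.X ^ p ^ n ∧
      Θ (1 ⊗ₜ russellCoord p n a 1) = ∑ i, Polynomial.C (b i) * Polynomial.X ^ p ^ (i : ℕ) ∧
      ∀ γ z, Θ z ∈ polyGrade ℒ r γ ↔ z ∈ tensorGrade k ℒ (russellGrade p n a 𝒦 r s) γ := by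
  let g : Polynomial L := ∑ i, Polynomial.C (b i) * Polynomial.X ^ p ^ (i : ℕ)
  have hrel : g ^ p ^ n = Polynomial.aeval (Polynomial.X ^ p ^ n) (pPolynomial p a) := by
    rw [aeval_pPolynomial, sum_pow_char_pow]
    refine Finset.sum_congr rfl fun i _ => ?_
    rw [mul_pow, ← pow_mul, ← pow_mul, mul_comm (p ^ (i : ℕ)), ← map_pow, ← hab,
      Polynomial.algebraMap_apply]
  let φ : RussellAlgebra p n a →ₐ[k] Polynomial L := russellLift (Polynomial.X ^ p ^ n) g hrel
  let Φ : (L ⊗[k] RussellAlgebra p n a) →ₐ[L] Polynomial L :=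
    Algebra.TensorProduct.lift (Algebra.ofId L _) φ fun _ _ => Commute.all _ _
  have hΦ0 : Φ (1 ⊗ₜ russellCoord p n a 0) = Polynomial.X ^ p ^ n := by
    simp [Φ, φ, russellLift_zero]
  have hΦ1 : Φ (1 ⊗ₜ russellCoord p n a 1) = g := by
    simp [Φ, φ, russellLift_one]
  -- The existence of `Φ` shows that `L` embeds into the tensor product.
  have : CharP (L ⊗[k] RussellAlgebra p n a) p := by
    refine charP_of_injective_ringHom (f := algebraMap L _) (fun x y hxy => ?_) p
    have := congrArg Φ hxy
    rw [Φ.commutes, Φ.commutes] at this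
    exact Polynomial.C_injective this
  -- The element `u` will be the preimage of `X`.
  obtain ⟨u, hur, hu0, hu1⟩ := exists_pow_eq_and_sum_eq
    (𝒮 := tensorGrade k ℒ (russellGrade p n a 𝒦 r s)) p n (r := r) (s := s)
    (fun i => b i ⊗ₜ[k] (1 : RussellAlgebra p n a)) (fun i => by
      have := tmul_mem_tensorGrade (R := k) (hb i)
        (SetLike.GradedOne.one_mem (A := russellGrade p n a 𝒦 r s))
      rwa [add_zero] at this) (c ⊗ₜ 1) (by
      have := tmul_mem_tensorGrade (R := k) hc
        (SetLike.GradedOne.one_mem (A := russellGrade p n a 𝒦 r s))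
      rwa [add_zero] at this)
    (by rw [Algebra.TensorProduct.tmul_mul_tmul, hcb, one_mul, Algebra.TensorProduct.one_def])
    (1 ⊗ₜ russellCoord p n a 0) (1 ⊗ₜ russellCoord p n a 1) (by
      have := tmul_mem_tensorGrade (R := k) (SetLike.GradedOne.one_mem (A := ℒ))
        (russellCoord_mem (p := p) (n := n) (a := a) (𝒦 := 𝒦) r s 0)
      rwa [zero_add] at this) (by
      have := tmul_mem_tensorGrade (R := k) (SetLike.GradedOne.one_mem (A := ℒ))
        (russellCoord_mem (p := p) (n := n) (a := a) (𝒦 := 𝒦) r s 1)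
      rwa [zero_add] at this) (by
      simp only [Algebra.TensorProduct.tmul_pow, one_pow, Algebra.TensorProduct.tmul_mul_tmul,
        mul_one, one_mul, russellCoord_one_pow, aeval_pPolynomial, TensorProduct.tmul_sum, ← hab]
      refine Finset.sum_congr rfl fun i _ => ?_
      rw [← Algebra.smul_def, TensorProduct.tmul_smul, Algebra.algebraMap_eq_smul_one,
        TensorProduct.smul_tmul'])
  -- The iterated Frobenius is injective on the domain `L[X]`, and `Φ u` and `X` have the same
  -- `p^n`-th power.
  have hΦu : Φ u = Polynomial.X := by
    have := congrArg Φ hu0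
    rw [map_pow, hΦ0] at this
    exact iterateFrobenius_inj (Polynomial L) p n this
  let Ψ : Polynomial L →ₐ[L] (L ⊗[k] RussellAlgebra p n a) := Polynomial.aeval u
  have hg : Ψ g = 1 ⊗ₜ russellCoord p n a 1 := by
    rw [← hu1]
    simp [Ψ, g, Algebra.TensorProduct.algebraMap_apply]
  let Θ : (L ⊗[k] RussellAlgebra p n a) ≃ₐ[L] Polynomial L := AlgEquiv.ofAlgHom Φ Ψ
    (by
      refine Polynomial.algHom_ext ?_
      simp [Ψ, hΦu])
    (by
      refine Algebra.TensorProduct.ext (by ext) (russellAlgebra_algHom_ext fun j => ?_)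
      change Ψ (Φ (1 ⊗ₜ _)) = 1 ⊗ₜ _
      fin_cases j
      · change Ψ (Φ (1 ⊗ₜ russellCoord p n a 0)) = 1 ⊗ₜ russellCoord p n a 0
        rw [hΦ0]
        simp [Ψ, hu0]
      · change Ψ (Φ (1 ⊗ₜ russellCoord p n a 1)) = 1 ⊗ₜ russellCoord p n a 1
        rw [hΦ1, hg])
  refine ⟨Θ, hΦ0, hΦ1, fun γ z => ⟨fun hz => ?_, fun hz => ?_⟩⟩
  · rw [← Θ.symm_apply_apply z]
    refine eval₂_mem_of_mem_polyGrade (𝒜 := ℒ) _ (fun γ x hx => ?_) hur hz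
    have := tmul_mem_tensorGrade (R := k) hx
      (SetLike.GradedOne.one_mem (A := russellGrade p n a 𝒦 r s))
    rwa [add_zero] at this
  · refine map_mem_of_mem_tensorGrade (ℳ := ℒ) (𝒩 := russellGrade p n a 𝒦 r s)
      (𝒢 := polyGrade ℒ r) Φ.toRingHom.toAddMonoidHom (fun δ τ x hx y hy => ?_) hz
    have hLX : ∀ γ, ∀ x ∈ 𝒦 γ, algebraMap k (Polynomial L) x ∈ polyGrade ℒ r γ :=
      fun γ x hx => C_mem_polyGrade (hL γ x hx)
    have hy' : φ y ∈ polyGrade ℒ r τ := by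
      refine map_mem_of_mem_russellGrade (𝒮 := polyGrade ℒ r) hLX φ ?_ ?_ hy
      · rw [russellLift_zero]
        exact SetLike.pow_mem_graded _ (X_mem_polyGrade r)
      · rw [russellLift_one]
        refine sum_mem fun i _ => ?_
        have := SetLike.mul_mem_graded (C_mem_polyGrade (r := r) (hb i))
          (SetLike.pow_mem_graded (p ^ (i : ℕ)) (X_mem_polyGrade (𝒜 := ℒ) r))
        rwa [sub_add_cancel] at this
    have : Φ (x ⊗ₜ y) = Polynomial.C x * φ y := by
      simp [Φ, Algebra.ofId_apply]
    exact this ▸ SetLike.mul_mem_graded (C_mem_polyGrade hx) hy'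

end Russell

end RussellGraded

namespace RussellGraded

/-! ### The Hopf algebra structure on the algebras of Russell type -/

section RussellHopf

variable {p n : ℕ} [Fact p.Prime] {k : Type*} [CommRing k] [CharP k p] {m : ℕ}
  {a : Fin (m + 1) → k} {𝒦 : Degree → AddSubgroup k}

theorem comul_russellCoord (j : Fin 2) : Coalgebra.comul (R := k) (russellCoord p n a j) =
    russellCoord p n a j ⊗ₜ 1 + 1 ⊗ₜ russellCoord p n a j := by
  have h : Coalgebra.comul (R := k) (coord j : AddGroupAlgebra k 2) =
      coord j ⊗ₜ 1 + 1 ⊗ₜ coord j :=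
    coordLift_coord (k := k) (fun j : Fin 2 => coord j ⊗ₜ[k] 1 + 1 ⊗ₜ[k] coord j) j
  change TensorProduct.map _ _ (Coalgebra.comul (R := k) (coord j : AddGroupAlgebra k 2)) = _
  rw [h]
  rfl

theorem counit_russellCoord (j : Fin 2) :
    Coalgebra.counit (R := k) (russellCoord p n a j) = 0 :=
  coordLift_coord (k := k) (fun _ : Fin 2 => (0 : k)) j

theorem antipode_russellCoord (j : Fin 2) :
    HopfAlgebra.antipode k (russellCoord p n a j) = -russellCoord p n a j :=
  (congrArg (Ideal.Quotient.mk (russellIdeal p n a)) (coordLift_coord (k := k) _ j)).trans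
    (map_neg _ _)

theorem isGradedHopfAlgebra_russellGrade (h𝒦 : Nonempty (GradedRing 𝒦)) {r s : Degree}
    (hR : Nonempty (GradedRing (russellGrade p n a 𝒦 r s))) :
    IsGradedHopfAlgebra 𝒦 (russellGrade p n a 𝒦 r s) := by
  obtain ⟨_⟩ := h𝒦
  have hmem : ∀ j, russellCoord p n a j ∈ russellGrade p n a 𝒦 r s (![p ^ n • r, s] j) :=
    russellCoord_mem r s
  have hone : (1 : RussellAlgebra p n a) ∈ russellGrade p n a 𝒦 r s 0 := SetLike.GradedOne.one_mem
  have hcomul : ∀ j, Coalgebra.comul (R := k) (russellCoord p n a j) ∈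
      tensorGrade k (russellGrade p n a 𝒦 r s) (russellGrade p n a 𝒦 r s)
        (![p ^ n • r, s] j) := by
    intro j
    rw [comul_russellCoord]
    refine add_mem ?_ ?_
    · simpa using tmul_mem_tensorGrade (R := k) (hmem j) hone
    · simpa using tmul_mem_tensorGrade (R := k) hone (hmem j)
  refine ⟨⟨hR, fun γ x hx => algebraMap_mem_russellGrade r s hx⟩, fun γ z hz => ?_,
    fun γ z hz => ?_, fun γ z hz => ?_⟩
  · refine map_mem_of_mem_russellGrade (fun γ x hx => ?_)
      (Bialgebra.comulAlgHom k (RussellAlgebra p n a)) (hcomul 0) (hcomul 1) hz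
    have := tmul_mem_tensorGrade (R := k) (algebraMap_mem_russellGrade (p := p) (n := n) (a := a)
      r s hx) hone
    rwa [add_zero] at this
  · refine map_mem_of_mem_russellGrade (𝒮 := 𝒦) (fun γ x hx => hx)
      (Bialgebra.counitAlgHom k (RussellAlgebra p n a)) ?_ ?_ hz
    · exact (counit_russellCoord (p := p) (n := n) (a := a) 0) ▸ zero_mem _
    · exact (counit_russellCoord (p := p) (n := n) (a := a) 1) ▸ zero_mem _
  · refine map_mem_of_mem_russellGrade
      (fun γ x hx => algebraMap_mem_russellGrade (p := p) (n := n) (a := a) r s hx)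
      (HopfAlgebra.antipodeAlgHom k (RussellAlgebra p n a)) ?_ ?_ hz
    · exact (antipode_russellCoord (p := p) (n := n) (a := a) 0) ▸ neg_mem (hmem 0)
    · exact (antipode_russellCoord (p := p) (n := n) (a := a) 1) ▸ neg_mem (hmem 1)

end RussellHopf

/-- The quotient grading, obtained from the embedding into the polynomial ring over `L`. -/
theorem nonempty_gradedRing_russellGrade {p n : ℕ} {k : Type*} [CommRing k]
    {m : ℕ} {a : Fin (m + 1) → k} {𝒦 : Degree → AddSubgroup k} {L : Type*} [CommRing L] [Algebra k L]
    [Module.FaithfullyFlat k L] {ℒ : Degree → AddSubgroup L} [GradedRing 𝒦] [GradedRing ℒ]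
    {r s : Degree} (Θ : (L ⊗[k] RussellAlgebra p n a) ≃ₐ[L] Polynomial L)
    (hΘ : ∀ γ z, Θ z ∈ polyGrade ℒ r γ ↔ z ∈ tensorGrade k ℒ (russellGrade p n a 𝒦 r s) γ) :
    Nonempty (GradedRing (russellGrade p n a 𝒦 r s)) := by
  -- Coefficient sequences suffice as ambient group: the projection to degree `δ` takes the
  -- component of degree `δ - i • r` of the `i`-th coefficient.
  let ι : RussellAlgebra p n a →+ (ℕ → L) :=
    { toFun := fun z => (Θ (1 ⊗ₜ z)).coeff
      map_zero' := by ext; simp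
      map_add' := fun x y => by ext; simp [TensorProduct.tmul_add] }
  have hι : ∀ γ, ∀ x ∈ russellGrade p n a 𝒦 r s γ, ∀ i, ι x i ∈ ℒ (γ - i • r) := by
    intro γ x hx
    refine (hΘ γ _).mpr ?_
    have := tmul_mem_tensorGrade (R := k) (SetLike.GradedOne.one_mem (A := ℒ)) hx
    rwa [zero_add] at this
  refine nonempty_gradedRing_of_injective (russellGrade_mem_closure r s) ι (fun x y hxy => ?_)
    (fun δ => AddMonoidHom.pi fun i =>
      (GradedRing.proj ℒ (δ - i • r)).comp (Pi.evalAddMonoidHom (fun _ => L) i))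
    (fun γ x hx => ?_) (fun γ δ hγδ x hx => ?_)
  · exact Module.FaithfullyFlat.tensorProduct_mk_injective (A := k) (B := L) _
      (Θ.injective (Polynomial.ext fun i => congrFun hxy i))
  · ext i
    exact DirectSum.decompose_of_mem_same ℒ (hι γ x hx i)
  · ext i
    exact DirectSum.decompose_of_mem_ne ℒ (hι γ x hx i) fun h => hγδ (sub_left_injective h)

end RussellGraded

namespace RussellGraded

/-! ### Hopf algebras that become polynomial rings in one variable -/

section FormPoint

open WithConv

variable {k L A : Type*} [CommRing k] [CommRing L] [Algebra k L] [CommRing A] [HopfAlgebra k A]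
  (θ : (L ⊗[k] A) ≃ₐ[L] Polynomial L)
  {S : Type*} [CommRing S] [Algebra k S] [Algebra L S] [IsScalarTower k L S]
  {S' : Type*} [CommRing S'] [Algebra k S'] [Algebra L S'] [IsScalarTower k L S']

/-- The `S`-valued point of `Spec A` with coordinate `u`. -/
noncomputable def formPoint (u : S) : A →ₐ[k] S :=
  ((Polynomial.aeval u).restrictScalars k).comp
    ((θ.toAlgHom.restrictScalars k).comp Algebra.TensorProduct.includeRight)

/-- The coordinate of an `S`-valued point of `Spec A`. -/
noncomputable def formCoord (φ : A →ₐ[k] S) : S :=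
  Algebra.TensorProduct.lift (Algebra.ofId L S) φ (fun _ _ => Commute.all _ _)
    (θ.symm Polynomial.X)

theorem formPoint_apply (u : S) (a : A) :
    formPoint θ u a = Polynomial.aeval u (θ (1 ⊗ₜ a)) :=
  rfl

theorem lift_formPoint (u : S) : Algebra.TensorProduct.lift (Algebra.ofId L S) (formPoint θ u)
    (fun _ _ => Commute.all _ _) = (Polynomial.aeval u).comp θ.toAlgHom :=
  Algebra.TensorProduct.ext (by ext) (by ext a; simp [formPoint_apply])

@[simp]
theorem formCoord_formPoint (u : S) : formCoord θ (formPoint θ u) = u := by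
  rw [formCoord, lift_formPoint]
  simp

@[simp]
theorem formPoint_formCoord (φ : A →ₐ[k] S) : formPoint θ (formCoord θ φ) = φ := by
  have h : Polynomial.aeval (formCoord θ φ) =
      (Algebra.TensorProduct.lift (Algebra.ofId L S) φ (fun _ _ => Commute.all _ _)).comp
        θ.symm.toAlgHom := by
    refine Polynomial.algHom_ext ?_
    simp [formCoord]
  ext a
  rw [formPoint_apply, h]
  simp

theorem comp_formPoint (σ : S →ₐ[L] S') (u : S) :
    (σ.restrictScalars k).comp (formPoint θ u) = formPoint θ (σ u) := by
  ext a
  simp [formPoint_apply, Polynomial.aeval_algHom_apply]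

theorem map_formCoord (σ : S →ₐ[L] S') (φ : A →ₐ[k] S) :
    σ (formCoord θ φ) = formCoord θ ((σ.restrictScalars k).comp φ) := by
  conv_rhs => rw [← formPoint_formCoord θ φ, comp_formPoint, formCoord_formPoint]

/-- The group law of `Spec A` in terms of the coordinate. -/
noncomputable def formMul (u v : S) : S :=
  formCoord θ (toConv (formPoint θ u) * toConv (formPoint θ v)).ofConv

theorem formPoint_formMul (u v : S) : formPoint θ (formMul θ u v) =
    (toConv (formPoint θ u) * toConv (formPoint θ v)).ofConv :=
  formPoint_formCoord θ _

/-- Naturality of the group law: every identity can be derived from the universal points `X` and `C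
X`. -/
theorem map_formMul (σ : S →ₐ[L] S') (u v : S) :
    σ (formMul θ u v) = formMul θ (σ u) (σ v) := by
  rw [formMul, map_formCoord, AlgHom.comp_convMul_distrib]
  simp only [comp_formPoint]
  rfl

/-- The coordinate of the unit element. -/
noncomputable def formOne : L :=
  formCoord θ ((Algebra.ofId k L).comp (Bialgebra.counitAlgHom k A))

theorem formPoint_algebraMap_formOne : formPoint θ (algebraMap L S (formOne θ)) =
    (1 : WithConv (A →ₐ[k] S)).ofConv := by
  have := comp_formPoint θ (Algebra.ofId L S) (formOne θ)
  rw [Algebra.ofId_apply] at this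
  rw [← this, formOne, formPoint_formCoord]
  ext a
  exact (IsScalarTower.algebraMap_apply k L S _).symm

theorem formMul_assoc (u v w : S) :
    formMul θ (formMul θ u v) w = formMul θ u (formMul θ v w) := by
  rw [formMul, formPoint_formMul, toConv_ofConv, mul_assoc, formMul, formPoint_formMul,
    toConv_ofConv]

theorem formMul_one (u : S) : formMul θ u (algebraMap L S (formOne θ)) = u := by
  rw [formMul, formPoint_algebraMap_formOne, toConv_ofConv, mul_one, ofConv_toConv,
    formCoord_formPoint]

theorem one_formMul (u : S) : formMul θ (algebraMap L S (formOne θ)) u = u := by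
  rw [formMul, formPoint_algebraMap_formOne, toConv_ofConv, one_mul, ofConv_toConv,
    formCoord_formPoint]

theorem exists_formMul_eq_one (u : S) : ∃ v, formMul θ v u = algebraMap L S (formOne θ) := by
  refine ⟨formCoord θ ((formPoint θ u).comp (HopfAlgebra.antipodeAlgHom k A)), ?_⟩
  rw [← formCoord_formPoint θ (algebraMap L S (formOne θ)), formMul, formPoint_formCoord,
    formPoint_algebraMap_formOne]
  congr 1
  have := AlgHom.comp_convMul_distrib (formPoint θ u)
    (toConv (HopfAlgebra.antipodeAlgHom k A)) (toConv (AlgHom.id k A))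
  rw [AlgHom.antipode_id_cancel] at this
  refine this.symm.trans ?_
  ext a
  simp

/-- A one-dimensional polynomial group law over an integral domain is additive, up to the
translation that maps the unit element to the origin. -/
theorem formMul_eq [IsDomain L] (u v : S) :
    formMul θ u v = u + v - algebraMap L S (formOne θ) := by
  let R := Polynomial L
  -- Naturality along the substitution `X ↦ z`.
  have hcomp : ∀ (w : R) (z : Polynomial R),
      formMul θ (Polynomial.C w) z = (formMul θ (Polynomial.C w) Polynomial.X).comp z := by
    intro w z
    have := map_formMul θ ((Polynomial.aeval (R := R) z).restrictScalars L) (Polynomial.C w)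
      Polynomial.X
    simp only [AlgHom.restrictScalars_apply, Polynomial.aeval_C, Polynomial.aeval_X] at this
    exact this.symm
  -- Here `w` is the inverse of the generic point `X` of `L[X]`. Translation by `w` undoes
  -- translation by the generic point, so `G ∘ F = X` and `F` has degree one in the second variable.
  obtain ⟨w, hw⟩ := exists_formMul_eq_one θ (Polynomial.X : R)
  let F : Polynomial R := formMul θ (Polynomial.C Polynomial.X) Polynomial.X
  let G : Polynomial R := formMul θ (Polynomial.C w) Polynomial.X
  have hGF : G.comp F = Polynomial.X := by
    rw [← hcomp, ← formMul_assoc]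
    have h := map_formMul θ (Algebra.ofId R (Polynomial R)|>.restrictScalars L) w Polynomial.X
    rw [hw] at h
    have h' : formMul θ (Polynomial.C w) (Polynomial.C (Polynomial.X : R)) =
        algebraMap L (Polynomial R) (formOne θ) := h.symm
    rw [h', one_formMul]
  have hdeg : F.natDegree = 1 := by
    have := congrArg Polynomial.natDegree hGF
    rw [Polynomial.natDegree_comp, Polynomial.natDegree_X] at this
    exact Nat.eq_one_of_mul_eq_one_left this
  -- The leading coefficient of `F` is a unit of `L[X]`, hence a constant `c`, because `L` is a
  -- domain.
  have hlc : IsUnit F.leadingCoeff := by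
    have := congrArg Polynomial.leadingCoeff hGF
    rw [Polynomial.leadingCoeff_comp (by rw [hdeg]; exact one_ne_zero),
      Polynomial.leadingCoeff_X] at this
    have hG : G.natDegree ≠ 0 := by
      intro h0
      have := congrArg Polynomial.natDegree hGF
      rw [Polynomial.natDegree_comp, h0, Polynomial.natDegree_X, zero_mul] at this
      exact zero_ne_one this
    refine (isUnit_pow_iff hG).mp (IsUnit.of_mul_eq_one _ ((mul_comm _ _).trans this))
  obtain ⟨c, -, hc⟩ := Polynomial.isUnit_iff.mp hlc
  obtain ⟨α, hF⟩ : ∃ α : R, F = Polynomial.C (Polynomial.C c) * Polynomial.X + Polynomial.C α :=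
    ⟨F.coeff 0, by
      conv_lhs => rw [Polynomial.eq_X_add_C_of_natDegree_le_one hdeg.le]
      rw [hc, Polynomial.leadingCoeff, hdeg]⟩
  -- The points `u`, `v` are specializations of the two generic points. The unit laws then give `c =
  -- 1` and determine `α`.
  have heval : ∀ (u v : S), formMul θ u v =
      algebraMap L S c * v + Polynomial.aeval u α := by
    intro u v
    have := map_formMul θ (Polynomial.aevalAeval (R := L) u v) (Polynomial.C Polynomial.X)
      (Polynomial.X)
    change Polynomial.aevalAeval u v F = _ at this
    rw [hF] at this
    simpa using this.symm
  have h1 := formMul_one θ u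
  rw [heval] at h1
  have h2 : ∀ v : S, algebraMap L S c * v + Polynomial.aeval (algebraMap L S (formOne θ)) α = v :=
    fun v => (heval _ v).symm.trans (one_formMul θ v)
  have h3 : algebraMap L S c = 1 := by
    have := h2 1
    have h0 := h2 0
    rw [mul_zero, zero_add] at h0
    rwa [h0, add_zero, mul_one] at this
  rw [h3, one_mul] at h1
  rw [heval, h3, one_mul]
  linear_combination h1

end FormPoint

end RussellGraded

/-! ### Primitive elements of a form and additive polynomials -/

namespace RussellGraded

theorem aeval_C_X {L : Type*} [CommRing L] (f : Polynomial L) :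
    Polynomial.aeval (Polynomial.C Polynomial.X : Polynomial (Polynomial L)) f =
      Polynomial.C f := by
  have := Polynomial.aeval_algHom_apply
    ((Algebra.ofId (Polynomial L) (Polynomial (Polynomial L))).restrictScalars L) Polynomial.X f
  rw [Polynomial.aeval_X_left_apply] at this
  exact this

theorem aeval_X_eq_map {L : Type*} [CommRing L] (f : Polynomial L) :
    Polynomial.aeval (Polynomial.X : Polynomial (Polynomial L)) f = f.map Polynomial.C := by
  have : (Polynomial.aeval Polynomial.X : Polynomial L →ₐ[L] Polynomial (Polynomial L)) =
      Polynomial.mapAlgHom (Algebra.ofId L (Polynomial L)) := Polynomial.algHom_ext (by simp)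
  exact DFunLike.congr_fun this f

section Primitive

open WithConv

variable {k L A : Type*} [CommRing k] [CommRing L] [Algebra k L] [CommRing A] [HopfAlgebra k A]
  (θ : (L ⊗[k] A) ≃ₐ[L] Polynomial L)

/-- The embedding of `L ⊗ (A ⊗ A)` into the polynomial ring in two variables. -/
noncomputable def formTensor : (L ⊗[k] (A ⊗[k] A)) →ₐ[L] Polynomial (Polynomial L) :=
  Algebra.TensorProduct.lift (Algebra.ofId L _)
    (Algebra.TensorProduct.lift (formPoint θ (Polynomial.C Polynomial.X))
      (formPoint θ Polynomial.X) fun _ _ => Commute.all _ _) fun _ _ => Commute.all _ _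

theorem formTensor_tmul (c : L) (a b : A) : formTensor θ (c ⊗ₜ (a ⊗ₜ b)) =
    Polynomial.C (θ (c ⊗ₜ a)) * (θ (1 ⊗ₜ b)).map Polynomial.C := by
  have h3 : θ (c ⊗ₜ a) = c • θ (1 ⊗ₜ a) := by
    rw [← map_smul, TensorProduct.smul_tmul', smul_eq_mul, mul_one]
  simp only [formTensor, Algebra.TensorProduct.lift_tmul, formPoint_apply, aeval_C_X, aeval_X_eq_map, h3,
    Algebra.ofId_apply, Polynomial.smul_eq_C_mul, map_mul, mul_assoc]
  rfl

/-- The map is a composite of linear isomorphisms `L ⊗ (A ⊗ A) ≅ (L ⊗ A) ⊗ A ≅ L[X] ⊗ A ≅ L[X] ⊗_L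
(L ⊗ A) ≅ L[X] ⊗_L L[X] ≅ L[X][Y]`. -/
theorem formTensor_injective : Function.Injective (formTensor θ) := by
  let e1 := (TensorProduct.assoc k L A A).symm
  let e2 := TensorProduct.congr (θ.toLinearEquiv.restrictScalars k) (LinearEquiv.refl k A)
  let e3 := (TensorProduct.AlgebraTensorModule.cancelBaseChange k L L (Polynomial L) A).symm
  let e4 := TensorProduct.congr (LinearEquiv.refl L (Polynomial L)) θ.toLinearEquiv
  let e5 := (polyEquivTensor' L (Polynomial L)).symm
  have h : ∀ z, formTensor θ z = e5 (e4 (e3 (e2 (e1 z)))) := by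
    intro z
    induction z with
    | zero => simp
    | add x y hx hy => simp only [map_add, hx, hy]
    | tmul c w =>
      induction w with
      | zero => simp
      | add x y hx hy => simp only [TensorProduct.tmul_add, map_add, hx, hy]
      | tmul a b =>
        rw [formTensor_tmul]
        simp only [e1, e2, e3, e4, e5, TensorProduct.assoc_symm_tmul, TensorProduct.congr_tmul,
          TensorProduct.AlgebraTensorModule.cancelBaseChange_symm_tmul]
        rw [← Polynomial.smul_eq_C_mul]
        rfl
  intro x y hxy
  rw [h, h] at hxy
  exact e1.injective (e2.injective (e3.injective (e4.injective (e5.injective hxy))))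

/-- The defect of primitivity. -/
noncomputable def primitiveDefect (k A : Type*) [CommRing k] [CommRing A] [HopfAlgebra k A] :
    A →ₗ[k] A ⊗[k] A :=
  Coalgebra.comul - Algebra.TensorProduct.includeLeft.toLinearMap -
    Algebra.TensorProduct.includeRight.toLinearMap

theorem primitiveDefect_eq_zero_iff {a : A} : primitiveDefect k A a = 0 ↔
    Coalgebra.comul (R := k) a = a ⊗ₜ 1 + 1 ⊗ₜ a := by
  rw [← sub_eq_zero (b := a ⊗ₜ[k] 1 + 1 ⊗ₜ a), ← sub_sub]
  rfl

theorem counit_eq_zero_of_comul_eq {a : A}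
    (h : Coalgebra.comul (R := k) a = a ⊗ₜ 1 + 1 ⊗ₜ a) : Coalgebra.counit (R := k) a = 0 := by
  have := congrArg (Coalgebra.counit (R := k)) (congrArg (TensorProduct.lid k A)
    (Coalgebra.rTensor_counit_comul (R := k) a))
  rw [h] at this
  simpa using this

variable [IsDomain L] (hθ : formOne θ = 0)

-- Once the unit is at the origin the group law is addition, so the defect of primitivity becomes
-- the defect of additivity `f(X + Y) - f(X) - f(Y)`.
include hθ in
theorem formTensor_lTensor_primitiveDefect (z : L ⊗[k] A) :
    formTensor θ ((primitiveDefect k A).lTensor L z) =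
      Polynomial.aeval (Polynomial.C Polynomial.X + Polynomial.X) (θ z) - Polynomial.C (θ z) -
        (θ z).map Polynomial.C := by
  induction z with
  | zero => simp
  | add x y hx hy =>
    simp only [map_add, hx, hy, Polynomial.map_add]
    ring
  | tmul c a =>
    have h1 : θ (c ⊗ₜ 1) = Polynomial.C c :=
      θ.commutes c
    have h2 : θ (c ⊗ₜ a) = Polynomial.C c * θ (1 ⊗ₜ a) := by
      rw [← h1, ← map_mul, Algebra.TensorProduct.tmul_mul_tmul, mul_one, one_mul]
    have h3 : formTensor θ (c ⊗ₜ Coalgebra.comul (R := k) a) =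
        Polynomial.aeval (Polynomial.C Polynomial.X + Polynomial.X) (θ (c ⊗ₜ a)) := by
      have h := DFunLike.congr_fun (formPoint_formMul θ
        (Polynomial.C Polynomial.X : Polynomial (Polynomial L)) Polynomial.X) a
      rw [formMul_eq, hθ, map_zero, sub_zero, formPoint_apply] at h
      rw [h2, map_mul, h, Polynomial.aeval_C, formTensor, Algebra.TensorProduct.lift_tmul]
      refine congrArg₂ (· * ·) rfl ?_
      exact (AlgHom.convMul_apply (toConv (formPoint θ
        (Polynomial.C Polynomial.X : Polynomial (Polynomial L))))
        (toConv (formPoint θ Polynomial.X)) a).symm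
    have h4 : (primitiveDefect k A).lTensor L (c ⊗ₜ a) =
        c ⊗ₜ Coalgebra.comul (R := k) a - c ⊗ₜ (a ⊗ₜ 1) - c ⊗ₜ (1 ⊗ₜ a) := by
      rw [← TensorProduct.tmul_sub, ← TensorProduct.tmul_sub]
      rfl
    have h5 : θ (1 ⊗ₜ 1) = 1 := map_one θ
    rw [h4, map_sub, map_sub, h3, formTensor_tmul, formTensor_tmul, h1, h5, Polynomial.map_one,
      mul_one]
    rw [h2, Polynomial.map_mul, Polynomial.map_C]

-- The defect can be tested after base change by faithful flatness, and then in `L[X][Y]` by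
-- injectivity of `formTensor`.
include hθ in
theorem comul_eq_iff_additive [Module.FaithfullyFlat k L] {a : A} :
    Coalgebra.comul (R := k) a = a ⊗ₜ 1 + 1 ⊗ₜ a ↔
      Polynomial.aeval (Polynomial.C Polynomial.X + Polynomial.X :
        Polynomial (Polynomial L)) (θ (1 ⊗ₜ a)) =
        Polynomial.C (θ (1 ⊗ₜ a)) + (θ (1 ⊗ₜ a)).map Polynomial.C := by
  rw [← primitiveDefect_eq_zero_iff, ← sub_eq_zero (b := Polynomial.C (θ (1 ⊗ₜ a)) + _),
    ← sub_sub, ← formTensor_lTensor_primitiveDefect θ hθ, map_eq_zero_iff _ (formTensor_injective θ),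
    LinearMap.lTensor_tmul, ← map_eq_zero_iff (TensorProduct.mk k L (A ⊗[k] A) 1)
      (Module.FaithfullyFlat.tensorProduct_mk_injective _), TensorProduct.mk_apply]

end Primitive

/-! ### Additive polynomials are `p`-polynomials -/

section Additive

variable {L : Type*} [CommRing L] [IsDomain L]

/-- The coefficient of `Y^v` in `f(X + Y)` is the Hasse derivative of order `v`. For `0 < v < i`,
additivity gives `(i choose v) fᵢ = 0`; if `fᵢ ≠ 0`, then `p` divides all these binomial
coefficients, and `i` is a power of `p`. -/
theorem coeff_eq_zero_of_additive (p : ℕ) [Fact p.Prime] [CharP L p] {f : Polynomial L}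
    (hf : Polynomial.aeval (Polynomial.C Polynomial.X + Polynomial.X :
      Polynomial (Polynomial L)) f = Polynomial.C f + f.map Polynomial.C) {i : ℕ}
    (hi : ∀ e : ℕ, i ≠ p ^ e) : f.coeff i = 0 := by
  have hd : ∀ v, Polynomial.hasseDeriv v f =
      (Polynomial.C f).coeff v + Polynomial.C (f.coeff v) := by
    intro v
    have := congrArg (fun g => Polynomial.coeff g v) hf
    have h1 : Polynomial.aeval (Polynomial.C Polynomial.X + Polynomial.X :
        Polynomial (Polynomial L)) f = Polynomial.taylor Polynomial.X (f.map Polynomial.C) := by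
      rw [Polynomial.taylor_apply, Polynomial.comp, Polynomial.eval₂_map, add_comm]
      rfl
    have h2 : Polynomial.hasseDeriv v (f.map Polynomial.C) =
        (Polynomial.hasseDeriv v f).map (Polynomial.C : L →+* Polynomial L) := by
      ext i : 1
      simp [Polynomial.hasseDeriv_coeff]
    rw [h1] at this
    simp only [Polynomial.taylor_coeff, Polynomial.coeff_add, Polynomial.coeff_map] at this
    rw [← this, h2, Polynomial.eval_map, Polynomial.eval₂_C_X]
  by_contra h0
  have hi0 : i ≠ 0 := by
    rintro rfl
    have := congrArg (fun g => Polynomial.coeff g 0) (hd 0)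
    simp at this
    exact h0 this
  refine hi _ (Choose.eq_pow_multiplicity_of_choose_modEq_zero_nat
    (p := p) (Nat.pos_of_ne_zero hi0) fun v hv => ?_)
  rw [Finset.mem_Icc] at hv
  have := congrArg (fun g => Polynomial.coeff g (i - v)) (hd v)
  simp only [Polynomial.hasseDeriv_coeff, Polynomial.coeff_add, Polynomial.coeff_C] at this
  rw [if_neg (by omega), if_neg (by omega), add_zero, Nat.sub_add_cancel (by omega)] at this
  exact (Nat.modEq_zero_iff_dvd).mpr ((CharP.cast_eq_zero_iff L p _).mp
    ((mul_eq_zero.mp this).resolve_right h0))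

/-- Since `e < p ^ e`, exponents `e` up to the degree of `f` suffice; the superfluous terms vanish.
-/
theorem eq_sum_of_coeff_eq_zero {L : Type*} [CommRing L] {p : ℕ} (hp : 1 < p) {f : Polynomial L}
    (hf : ∀ i : ℕ, (∀ e : ℕ, i ≠ p ^ e) → f.coeff i = 0) :
    f = ∑ i : Fin (f.natDegree + 1),
      Polynomial.C (f.coeff (p ^ (i : ℕ))) * Polynomial.X ^ p ^ (i : ℕ) := by
  ext j
  simp only [Polynomial.finsetSum_coeff, Polynomial.coeff_C_mul, Polynomial.coeff_X_pow]
  by_cases hj : ∃ e, j = p ^ e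
  · obtain ⟨e, rfl⟩ := hj
    by_cases he : e < f.natDegree + 1
    · rw [Finset.sum_eq_single ⟨e, he⟩]
      · simp
      · intro i _ hi
        rw [if_neg, mul_zero]
        intro h
        exact hi (Fin.ext (Nat.pow_right_injective hp h.symm))
      · simp
    · rw [Polynomial.coeff_eq_zero_of_natDegree_lt ((by omega : f.natDegree < e).trans
        (Nat.lt_pow_self hp))]
      refine (Finset.sum_eq_zero fun i _ => ?_).symm
      rw [if_neg, mul_zero]
      intro h
      have := Nat.pow_right_injective hp h
      omega
  · push Not at hj
    rw [hf j hj]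
    refine (Finset.sum_eq_zero fun i _ => ?_).symm
    rw [if_neg (hj _), mul_zero]

end Additive

end RussellGraded

/-! ### Homogeneous elements and descent from `L` to `k` -/

namespace RussellGraded

/-- The component of degree `-δ` of any inverse is already an inverse. -/
theorem exists_homogeneous_inverse {A : Type*} [CommRing A] {𝒜 : Degree → AddSubgroup A}
    [GradedRing 𝒜] {δ : Degree} {x : A} (hx : x ∈ 𝒜 δ) (hu : IsUnit x) :
    ∃ c ∈ 𝒜 (-δ), c * x = 1 := by
  obtain ⟨y, hy⟩ := hu.exists_left_inv
  refine ⟨DirectSum.decompose 𝒜 y (-δ), (DirectSum.decompose 𝒜 y (-δ)).2, ?_⟩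
  rw [← DirectSum.coe_decompose_mul_add_of_right_mem 𝒜 hx, hy, neg_add_cancel]
  exact DirectSum.decompose_of_mem_same 𝒜 SetLike.GradedOne.one_mem

theorem pPolynomial_mem_polyGrade_iff {p : ℕ} (hp : 1 < p) {k : Type*} [CommRing k]
    {𝒦 : Degree → AddSubgroup k} {m : ℕ} {a : Fin (m + 1) → k} {r γ : Degree} :
    pPolynomial p a ∈ polyGrade 𝒦 r γ ↔
      ∀ i : Fin (m + 1), a i ∈ 𝒦 (γ - p ^ (i : ℕ) • r) := by
  constructor
  · intro h i
    have := h (p ^ (i : ℕ))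
    rw [pPolynomial, Polynomial.finsetSum_coeff, Finset.sum_eq_single i] at this
    · simpa using this
    · intro j _ hj
      rw [Polynomial.coeff_C_mul, Polynomial.coeff_X_pow, if_neg, mul_zero]
      intro h
      exact hj (Fin.ext (Nat.pow_right_injective hp h.symm))
    · simp
  · intro h
    refine sum_mem fun i _ j => ?_
    rw [Polynomial.coeff_C_mul, Polynomial.coeff_X_pow]
    split_ifs with hj
    · subst hj
      simpa using h i
    · simp

section Form

variable {k L A : Type*} [CommRing k] [CommRing L] [Algebra k L]
  {𝒦 : Degree → AddSubgroup k} {ℒ : Degree → AddSubgroup L}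

theorem IsGradedField.faithfullyFlat (hk : IsGradedField 𝒦) (hL : IsGradedAlgebra 𝒦 ℒ)
    [Nontrivial L] : Module.FaithfullyFlat k L := by
  obtain ⟨ι, b, -⟩ := exists_homogeneous_basis hk hL
  have := Module.Free.of_basis b
  infer_instance

/-- The algebras of Russell type are graded Hopf algebras and graded forms of the polynomial
ring in one variable. -/
theorem isGradedHopfAlgebra_and_isGradedForm_russellGrade {p n : ℕ} [Fact p.Prime] [CharP k p]
    (hk : IsGradedField 𝒦) (hℒ : IsGradedField ℒ) (hL : IsGradedAlgebra 𝒦 ℒ)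
    (hroot : ∀ δ, ∀ c ∈ 𝒦 (p ^ n • δ), ∃ x ∈ ℒ δ, algebraMap k L c = x ^ p ^ n)
    {r s : Degree} {m : ℕ} {a : Fin (m + 1) → k}
    (ha : pPolynomial p a ∈ polyGrade 𝒦 (p ^ n • r) (p ^ n • s)) (ha0 : a 0 ≠ 0) :
    IsGradedHopfAlgebra 𝒦 (russellGrade p n a 𝒦 r s) ∧
      IsGradedForm k ℒ (russellGrade p n a 𝒦 r s) (polyGrade 𝒦 r) := by
  have := hℒ.isDomain
  have := hk.faithfullyFlat hL
  have hinj := hk.algebraMap_injective hL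
  have := charP_of_injective_algebraMap hinj p
  obtain ⟨_⟩ := hk.graded
  obtain ⟨_⟩ := hℒ.graded
  have hp : 1 < p := (Fact.out : p.Prime).one_lt
  rw [pPolynomial_mem_polyGrade_iff hp] at ha
  have hb : ∀ i : Fin (m + 1), ∃ x ∈ ℒ (s - p ^ (i : ℕ) • r), algebraMap k L (a i) = x ^ p ^ n := by
    intro i
    refine hroot _ _ ?_
    rw [nsmul_sub, smul_comm]
    exact ha i
  choose b hb hab using hb
  have hb0 : b 0 ≠ 0 := by
    intro h
    have := hab 0
    rw [h, zero_pow (pow_ne_zero n (by omega)), map_eq_zero_iff _ hinj] at this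
    exact ha0 this
  obtain ⟨c, hc, hcb⟩ := exists_homogeneous_inverse (hb 0) (hℒ.isUnit_of_ne_zero _ _ (hb 0) hb0)
  obtain ⟨Θ, -, -, hΘ⟩ := exists_gradedEquiv_russellAlgebra (𝒦 := 𝒦) hL.algebraMap_mem b hab hb
    (c := c) (by simpa using hc) hcb
  refine ⟨isGradedHopfAlgebra_russellGrade hk.graded (nonempty_gradedRing_russellGrade Θ hΘ),
    Θ.trans (polyEquivTensor' k L), fun γ z => ?_⟩
  rw [← polyEquivTensor'_symm_mem_polyGrade_iff hL.algebraMap_mem, ← hΘ, AlgEquiv.trans_apply,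
    AlgEquiv.symm_apply_apply]

variable [CommRing A] [HopfAlgebra k A] {𝒜 : Degree → AddSubgroup A}
  (θ : (L ⊗[k] A) ≃ₐ[L] Polynomial L)

/-- The coordinate `X` is primitive over `L`. Since the defect is `k`-linear and the `b j` are
independent, the coordinates `c j` of `X` are primitive; their linear coefficients cannot all
vanish, because that of `X` is `1`. -/
theorem exists_homogeneous_primitive [IsDomain L] (hk : IsGradedField 𝒦)
    (hL : IsGradedAlgebra 𝒦 ℒ) (hA : IsGradedAlgebra 𝒦 𝒜) (hθ : formOne θ = 0) {r : Degree}
    (hr : θ.symm Polynomial.X ∈ tensorGrade k ℒ 𝒜 r) :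
    ∃ s, ∃ y ∈ 𝒜 s, Coalgebra.comul (R := k) y = y ⊗ₜ 1 + 1 ⊗ₜ y ∧
      (θ (1 ⊗ₜ y)).coeff 1 ≠ 0 := by
  obtain ⟨ι, b, d, -, hd⟩ := exists_homogeneous_basis hk hL
  obtain ⟨c, hc, hX⟩ := exists_sum_tmul_of_mem_tensorGrade b d hA hd hr
  have hdef : ∀ j, primitiveDefect k A (c j) = 0 := by
    have h0 : (primitiveDefect k A).lTensor L (θ.symm Polynomial.X) = 0 := by
      refine formTensor_injective θ ?_
      rw [formTensor_lTensor_primitiveDefect θ hθ, AlgEquiv.apply_symm_apply]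
      simp
    have h1 : ((c.mapRange (primitiveDefect k A) (map_zero _)).sum
        fun j y => b j ⊗ₜ[k] y) = 0 := by
      rw [Finsupp.sum_mapRange_index (by simp), ← h0, hX, Finsupp.sum, Finsupp.sum, map_sum]
      rfl
    have h2 := TensorProduct.sum_tmul_basis_left_eq_zero b _ h1
    intro j
    simpa using DFunLike.congr_fun h2 j
  obtain ⟨j, hj⟩ : ∃ j, (θ (1 ⊗ₜ c j)).coeff 1 ≠ 0 := by
    by_contra! h
    have := congrArg (fun z => (θ z).coeff 1) hX
    simp only [AlgEquiv.apply_symm_apply, Polynomial.coeff_X_one, Finsupp.sum, map_sum,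
      Polynomial.finsetSum_coeff] at this
    rw [Finset.sum_eq_zero fun j _ => ?_] at this
    · exact one_ne_zero this
    · have h3 : b j ⊗ₜ[k] c j = b j • (1 ⊗ₜ[k] c j) := by
        rw [TensorProduct.smul_tmul', smul_eq_mul, mul_one]
      rw [h3, map_smul, Polynomial.coeff_smul, h, smul_zero]
  exact ⟨_, c j, hc j, primitiveDefect_eq_zero_iff.mp (hdef j), hj⟩

/-- By additivity of Frobenius, `X^{p^n} = ∑ bⱼ^{p^n} ⊗ cⱼ^{p^n}`, and the factors `bⱼ^{p^n}` lie in
`k`. -/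
theorem exists_homogeneous_pow {p n : ℕ} [Fact p.Prime] [CharP L p] (hk : IsGradedField 𝒦)
    (hL : IsGradedAlgebra 𝒦 ℒ) (hA : IsGradedAlgebra 𝒦 𝒜)
    (hinj : Function.Injective (algebraMap k L))
    (hpow : ∀ x : L, ∃ a : k, algebraMap k L a = x ^ p ^ n) {r : Degree}
    (hr : θ.symm Polynomial.X ∈ tensorGrade k ℒ 𝒜 r) :
    ∃ x ∈ 𝒜 (p ^ n • r), θ (1 ⊗ₜ x) = Polynomial.X ^ p ^ n := by
  obtain ⟨_⟩ := hk.graded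
  obtain ⟨_⟩ := hL.graded
  obtain ⟨_⟩ := hA.graded
  obtain ⟨ι, b, d, hbd, hd⟩ := exists_homogeneous_basis hk hL
  obtain ⟨c, hc, hX⟩ := exists_sum_tmul_of_mem_tensorGrade b d hA hd hr
  choose q hq using fun j => hpow (b j)
  have hqd : ∀ j, q j ∈ 𝒦 (p ^ n • d j) := fun j => by
    refine mem_of_map_mem (𝒮 := ℒ) (algebraMap k L).toAddMonoidHom hL.algebraMap_mem hinj ?_
    exact (hq j).symm ▸ SetLike.pow_mem_graded _ (hbd j)
  refine ⟨c.sum fun j y => q j • y ^ p ^ n, sum_mem fun j _ => ?_, ?_⟩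
  · have := hA.smul_mem (hqd j) (SetLike.pow_mem_graded (p ^ n) (hc j))
    rwa [← nsmul_add, add_sub_cancel] at this
  · rw [← θ.apply_symm_apply Polynomial.X, hX, Finsupp.sum, Finsupp.sum, map_sum, sum_pow_char_pow,
      TensorProduct.tmul_sum, map_sum]
    refine Finset.sum_congr rfl fun j _ => ?_
    rw [← map_pow θ, Algebra.TensorProduct.tmul_pow, ← hq, TensorProduct.tmul_smul,
      Algebra.algebraMap_eq_smul_one, TensorProduct.smul_tmul']

/-- The coordinate can be chosen to vanish at the unit element. -/
theorem exists_equiv_formOne_eq_zero (hℒ : Nonempty (GradedRing ℒ)) (hL : IsGradedAlgebra 𝒦 ℒ)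
    (hA : IsGradedHopfAlgebra 𝒦 𝒜) {r : Degree}
    (hθ : ∀ γ z, θ z ∈ polyGrade ℒ r γ ↔ z ∈ tensorGrade k ℒ 𝒜 γ) :
    ∃ θ' : (L ⊗[k] A) ≃ₐ[L] Polynomial L, formOne θ' = 0 ∧
      ∀ γ z, θ' z ∈ polyGrade ℒ r γ ↔ z ∈ tensorGrade k ℒ 𝒜 γ := by
  obtain ⟨_⟩ := hℒ
  have hX : θ.symm Polynomial.X ∈ tensorGrade k ℒ 𝒜 r := by
    rw [← hθ, AlgEquiv.apply_symm_apply]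
    exact X_mem_polyGrade r
  -- The unit coordinate is the counit of an element of degree `r`, so translation by it preserves
  -- the grading.
  have he : formOne θ ∈ ℒ r := by
    refine map_mem_of_mem_tensorGrade (ℳ := ℒ) (𝒩 := 𝒜) (𝒢 := ℒ)
      (Algebra.TensorProduct.lift (Algebra.ofId L L)
        ((Algebra.ofId k L).comp (Bialgebra.counitAlgHom k A))
        (fun _ _ => Commute.all _ _)).toRingHom.toAddMonoidHom (fun δ τ x hx y hy => ?_) hX
    exact SetLike.mul_mem_graded hx (hL.algebraMap_mem _ _ (hA.counit_mem _ _ hy))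
  have htr : ∀ t ∈ ℒ r, ∀ γ, ∀ f ∈ polyGrade ℒ r γ,
      Polynomial.aeval (Polynomial.X + Polynomial.C t) f ∈ polyGrade ℒ r γ := by
    intro t ht γ f hf
    exact eval₂_mem_of_mem_polyGrade (𝒜 := ℒ) (𝒮 := polyGrade ℒ r) Polynomial.C
      (fun γ x hx => C_mem_polyGrade hx) (add_mem (X_mem_polyGrade r) (C_mem_polyGrade ht)) hf
  let τ := Polynomial.algEquivAevalXAddC (formOne θ)
  refine ⟨θ.trans τ, ?_, fun γ z => ?_⟩
  · have : (θ.trans τ).symm Polynomial.X =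
        θ.symm Polynomial.X - algebraMap L _ (formOne θ) := by
      rw [AlgEquiv.symm_apply_eq, map_sub, AlgEquiv.trans_apply, AlgEquiv.apply_symm_apply,
        AlgEquiv.commutes]
      simp [τ]
    rw [formOne, formCoord, this, map_sub, AlgHom.commutes]
    exact sub_self _
  · rw [← hθ]
    refine ⟨fun h => ?_, fun h => htr _ he _ _ h⟩
    have h1 := htr _ (neg_mem he) _ _ h
    have h2 : Polynomial.aeval (Polynomial.X + Polynomial.C (-formOne θ)) (τ (θ z)) = θ z := by
      rw [map_neg, ← sub_eq_add_neg]
      exact τ.symm_apply_apply (θ z)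
    rwa [AlgEquiv.trans_apply, h2] at h1

end Form

end RussellGraded

/-! ### Classification of the Hopf algebra forms -/

namespace RussellGraded

section Classification

variable {k L A : Type*} [CommRing k] [CommRing L] [Algebra k L]
  {𝒦 : Degree → AddSubgroup k} {ℒ : Degree → AddSubgroup L}

/-- A bijective graded homomorphism from an algebra of Russell type to a graded Hopf algebra, given
by primitive elements, is an isomorphism of graded Hopf algebras. -/
theorem exists_bialgEquiv_of_bijective {p n : ℕ} [Fact p.Prime] [CharP k p] [CommRing A]
    [HopfAlgebra k A] {𝒜 : Degree → AddSubgroup A} (h𝒜 : IsGradedAlgebra 𝒦 𝒜) {r s : Degree}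
    {m : ℕ} {a : Fin (m + 1) → k} (hR : Nonempty (GradedRing (russellGrade p n a 𝒦 r s)))
    (φ : RussellAlgebra p n a →ₐ[k] A) (hφ : Function.Bijective φ)
    (hφ0 : φ (russellCoord p n a 0) ∈ 𝒜 (p ^ n • r)) (hφ1 : φ (russellCoord p n a 1) ∈ 𝒜 s)
    (hprim : ∀ j, Coalgebra.comul (R := k) (φ (russellCoord p n a j)) =
      φ (russellCoord p n a j) ⊗ₜ 1 + 1 ⊗ₜ φ (russellCoord p n a j)) :
    ∃ e : A ≃ₐc[k] RussellAlgebra p n a,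
      ∀ γ x, e x ∈ russellGrade p n a 𝒦 r s γ ↔ x ∈ 𝒜 γ := by
  obtain ⟨_⟩ := hR
  obtain ⟨_⟩ := h𝒜.graded
  let Φ : RussellAlgebra p n a →ₐc[k] A := BialgHom.ofAlgHom φ
    (russellAlgebra_algHom_ext fun j => by
      change Coalgebra.counit (R := k) (φ _) = Coalgebra.counit (R := k) (russellCoord p n a j)
      rw [counit_russellCoord, counit_eq_zero_of_comul_eq (hprim j)])
    (russellAlgebra_algHom_ext fun j => by
      change TensorProduct.map _ _ (Coalgebra.comul (R := k) (russellCoord p n a j)) =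
        Coalgebra.comul (R := k) (φ _)
      rw [comul_russellCoord, hprim, map_add, TensorProduct.map_tmul, TensorProduct.map_tmul]
      simp)
  have hmem : ∀ γ, ∀ z ∈ russellGrade p n a 𝒦 r s γ, φ z ∈ 𝒜 γ := fun γ z hz =>
    map_mem_of_mem_russellGrade h𝒜.algebraMap_mem φ hφ0 hφ1 hz
  let E : RussellAlgebra p n a ≃ₐc[k] A := BialgEquiv.ofBijective Φ hφ
  refine ⟨E.symm, fun γ x => ?_⟩
  have hx : φ (E.symm x) = x := E.apply_symm_apply x
  refine ⟨fun h => hx ▸ hmem γ _ h, fun h => ?_⟩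
  refine mem_of_map_mem (𝒮 := 𝒜) φ.toRingHom.toAddMonoidHom hmem hφ.1 ?_
  exact (congrArg (· ∈ 𝒜 γ) hx).mpr h

/-- Every graded Hopf algebra that is a graded form of the polynomial ring in one variable is
isomorphic to an algebra of Russell type. -/
theorem exists_bialgEquiv_russellAlgebra {p n : ℕ} [Fact p.Prime] [CharP k p]
    (hk : IsGradedField 𝒦) (hℒ : IsGradedField ℒ) (hL : IsGradedAlgebra 𝒦 ℒ)
    (hpow : ∀ x : L, ∃ a : k, algebraMap k L a = x ^ p ^ n) [CommRing A] [HopfAlgebra k A]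
    {𝒜 : Degree → AddSubgroup A} (h𝒜 : IsGradedHopfAlgebra 𝒦 𝒜) {r : Degree}
    (hform : IsGradedForm k ℒ 𝒜 (polyGrade 𝒦 r)) :
    ∃ s : Degree, (∃ γ ∈ unitDegrees ℒ, s = γ + r) ∧ ∃ (m : ℕ) (a : Fin (m + 1) → k),
      pPolynomial p a ∈ polyGrade 𝒦 (p ^ n • r) (p ^ n • s) ∧ a 0 ≠ 0 ∧
        ∃ e : A ≃ₐc[k] RussellAlgebra p n a,
          ∀ γ x, e x ∈ russellGrade p n a 𝒦 r s γ ↔ x ∈ 𝒜 γ := by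
  have := hℒ.isDomain
  have := hk.faithfullyFlat hL
  have hinj := hk.algebraMap_injective hL
  have := charP_of_injective_algebraMap hinj p
  have hp : 1 < p := (Fact.out : p.Prime).one_lt
  obtain ⟨_⟩ := hk.graded
  obtain ⟨_⟩ := hℒ.graded
  have hA := h𝒜.isGradedAlgebra
  obtain ⟨θ, hθ0, hθ⟩ : ∃ θ : (L ⊗[k] A) ≃ₐ[L] Polynomial L, formOne θ = 0 ∧
      ∀ γ z, θ z ∈ polyGrade ℒ r γ ↔ z ∈ tensorGrade k ℒ 𝒜 γ := by
    obtain ⟨e, he⟩ := hform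
    refine exists_equiv_formOne_eq_zero (e.trans (polyEquivTensor' k L).symm) hℒ.graded hL h𝒜
      fun γ z => ?_
    rw [AlgEquiv.trans_apply, polyEquivTensor'_symm_mem_polyGrade_iff hL.algebraMap_mem, he]
  have hX : θ.symm Polynomial.X ∈ tensorGrade k ℒ 𝒜 r := by
    rw [← hθ, AlgEquiv.apply_symm_apply]
    exact X_mem_polyGrade r
  obtain ⟨s, y, hy, hyprim, hy1⟩ := exists_homogeneous_primitive θ hk hL hA hθ0 hX
  obtain ⟨x, hx, hxX⟩ := exists_homogeneous_pow θ hk hL hA hinj hpow hX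
  have hxprim : Coalgebra.comul (R := k) x = x ⊗ₜ 1 + 1 ⊗ₜ x := by
    rw [comul_eq_iff_additive θ hθ0, hxX, map_pow, Polynomial.aeval_X, add_pow_char_pow]
    simp
  let f := θ (1 ⊗ₜ y)
  have hfgr : f ∈ polyGrade ℒ r s := by
    rw [hθ]
    have := tmul_mem_tensorGrade (R := k) (SetLike.GradedOne.one_mem (A := ℒ)) hy
    rwa [zero_add] at this
  have hf := eq_sum_of_coeff_eq_zero hp fun i hi =>
    coeff_eq_zero_of_additive p ((comul_eq_iff_additive θ hθ0).mp hyprim) hi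
  let b : Fin (f.natDegree + 1) → L := fun i => f.coeff (p ^ (i : ℕ))
  have hb : ∀ i : Fin (f.natDegree + 1), b i ∈ ℒ (s - p ^ (i : ℕ) • r) := fun i => hfgr _
  have hb0 : b 0 ≠ 0 := by simpa [b] using hy1
  have hu := hℒ.isUnit_of_ne_zero _ _ (hb 0) hb0
  choose a ha using fun i => hpow (b i)
  have ha0 : a 0 ≠ 0 := by
    intro h
    have := ha 0
    rw [h, map_zero] at this
    exact pow_ne_zero _ hb0 this.symm
  have hagr : pPolynomial p a ∈ polyGrade 𝒦 (p ^ n • r) (p ^ n • s) := by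
    rw [pPolynomial_mem_polyGrade_iff hp]
    intro i
    refine mem_of_map_mem (𝒮 := ℒ) (algebraMap k L).toAddMonoidHom hL.algebraMap_mem hinj ?_
    have := SetLike.pow_mem_graded (p ^ n) (hb i)
    rw [nsmul_sub, smul_comm] at this
    exact (ha i).symm ▸ this
  obtain ⟨c, hc, hcb⟩ := exists_homogeneous_inverse (hb 0) hu
  obtain ⟨Θ, hΘ0, hΘ1, hΘ⟩ := exists_gradedEquiv_russellAlgebra (𝒦 := 𝒦) hL.algebraMap_mem b ha hb
    (c := c) (by simpa using hc) hcb
  -- The relation is checked in `L[X]`, where it is the image under `Θ` of the defining relation of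
  -- the Russell algebra: `θ` and `Θ` give `(x, y)` and `(T₁, T₂)` the same values.
  have hrel : y ^ p ^ n = Polynomial.aeval x (pPolynomial p a) := by
    refine Module.FaithfullyFlat.tensorProduct_mk_injective (A := k) (B := L) _ (θ.injective ?_)
    have h1 : ∀ w : A, TensorProduct.mk k L A 1 w =
      (Algebra.TensorProduct.includeRight : A →ₐ[k] L ⊗[k] A) w := fun _ => rfl
    have h2 : θ ((Algebra.TensorProduct.includeRight : A →ₐ[k] L ⊗[k] A) y) = f := rfl
    have h3 : θ ((Algebra.TensorProduct.includeRight : A →ₐ[k] L ⊗[k] A) x) =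
      Polynomial.X ^ p ^ n := hxX
    have h4 := Polynomial.aeval_algHom_apply ((θ.toAlgHom.restrictScalars k).comp
      (Algebra.TensorProduct.includeRight : A →ₐ[k] L ⊗[k] A)) x (pPolynomial p a)
    have h5 := map_pow Θ (1 ⊗ₜ russellCoord p n a 1) (p ^ n)
    rw [Algebra.TensorProduct.tmul_pow, one_pow, russellCoord_one_pow, hΘ1] at h5
    have h6 := Polynomial.aeval_algHom_apply ((Θ.toAlgHom.restrictScalars k).comp
      (Algebra.TensorProduct.includeRight : _ →ₐ[k] L ⊗[k] RussellAlgebra p n a))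
      (russellCoord p n a 0) (pPolynomial p a)
    rw [h1, h1, map_pow, map_pow, h2]
    refine Eq.trans ?_ h4
    refine Eq.trans ?_ ((congrArg (Polynomial.aeval · (pPolynomial p a))
      (hΘ0.trans h3.symm)).symm.trans h6).symm
    exact (congrArg (· ^ p ^ n) hf).trans h5.symm
  let φ := russellLift x y hrel
  have hφ0 : φ (russellCoord p n a 0) = x := russellLift_zero x y hrel
  have hφ1 : φ (russellCoord p n a 1) = y := russellLift_one x y hrel
  -- After base change `φ` is `θ⁻¹ ∘ Θ`, and faithful flatness descends bijectivity.
  have hφ : Function.Bijective φ := by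
    have h1 : θ.toAlgHom.comp (Algebra.TensorProduct.map (AlgHom.id L L) φ) = Θ.toAlgHom := by
      refine Algebra.TensorProduct.ext (by ext) (russellAlgebra_algHom_ext fun j => ?_)
      change θ (1 ⊗ₜ φ (russellCoord p n a j)) = Θ (1 ⊗ₜ russellCoord p n a j)
      fin_cases j
      · exact (congrArg (fun w => θ (1 ⊗ₜ w)) hφ0).trans (hxX.trans hΘ0.symm)
      · exact (congrArg (fun w => θ (1 ⊗ₜ w)) hφ1).trans (hf.trans hΘ1.symm)
    have h2 : ∀ z, (φ.toLinearMap.lTensor L) z = θ.symm (Θ z) := fun z =>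
      (θ.symm_apply_apply _).symm.trans (congrArg θ.symm (DFunLike.congr_fun h1 z))
    refine (Module.FaithfullyFlat.lTensor_bijective_iff_bijective k L φ.toLinearMap).mp ?_
    rw [funext h2]
    exact θ.symm.bijective.comp Θ.bijective
  -- The linear coefficient `b 0` is a unit of degree `s - r`. The length `m` is the degree of `f`,
  -- and the top coefficients may be zero.
  refine ⟨s, ⟨s - r, ⟨b 0, hu, by simpa using hb 0⟩, (sub_add_cancel s r).symm⟩, f.natDegree, a,
    hagr, ha0, exists_bialgEquiv_of_bijective hA (nonempty_gradedRing_russellGrade Θ hΘ) φ hφ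
      (hφ0 ▸ hx) (hφ1 ▸ hy) fun j => ?_⟩
  fin_cases j
  · exact hφ0.symm ▸ hxprim
  · exact hφ1.symm ▸ hyprim

end Classification

end RussellGraded

namespace RussellGraded

/-! ### The extension `k^{p^{-n}}` -/

section RootSubalgebra

variable {p n : ℕ} [Fact p.Prime] {k K : Type*} [CommRing k] [CharP k p] [CommRing K]
  [Algebra k K] {𝒦 : Degree → AddSubgroup k} {ℋ : Degree → AddSubgroup K}

theorem exists_algebraMap_rootSubalgebra_eq (x : rootSubalgebra p n k K) :
    ∃ a : k, algebraMap k (rootSubalgebra p n k K) a = x ^ p ^ n := by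
  obtain ⟨a, ha⟩ := x.2
  exact ⟨a, Subtype.ext ha⟩

theorem mem_rootGrade_iff {γ : Degree} {x : rootSubalgebra p n k K} :
    x ∈ rootGrade p n k ℋ γ ↔ (x : K) ∈ ℋ γ :=
  Iff.rfl

/-- Raising to the power `p^n` is additive and multiplies degrees by `p^n`, which is injective on
the torsion-free group of degrees. So the power of a component of `x` is a component of the power of
`x`, hence comes from `k`. -/
theorem decompose_mem_rootSubalgebra [GradedRing 𝒦] [GradedRing ℋ] [CharP K p]
    (hK : IsGradedAlgebra 𝒦 ℋ) {x : K} (hx : x ∈ rootSubalgebra p n k K) (γ : Degree) :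
    (DirectSum.decompose ℋ x γ : K) ∈ rootSubalgebra p n k K := by
  classical
  obtain ⟨a, ha⟩ := hx
  refine ⟨DirectSum.decompose 𝒦 a (p ^ n • γ), ?_⟩
  have h1 := map_decompose_of_graded (𝒜 := 𝒦) (𝒮 := ℋ) (algebraMap k K).toAddMonoidHom
    hK.algebraMap_mem (p ^ n • γ) a
  refine h1.trans ?_
  change (DirectSum.decompose ℋ (algebraMap k K a) (p ^ n • γ) : K) = _
  rw [ha]
  clear h1 ha
  induction x using DirectSum.Decomposition.inductionOn ℋ with
  | zero => simp [zero_pow (pow_ne_zero n (Fact.out : p.Prime).ne_zero)]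
  | add x y hx hy =>
    simp only [add_pow_char_pow, DirectSum.decompose_add, DirectSum.add_apply,
      AddMemClass.coe_add, hx, hy]
  | @homogeneous δ x =>
    have hpow := SetLike.pow_mem_graded (p ^ n) x.2
    rcases eq_or_ne δ γ with rfl | h
    · rw [DirectSum.decompose_of_mem_same ℋ hpow, DirectSum.decompose_of_mem_same ℋ x.2]
    · rw [DirectSum.decompose_of_mem_ne ℋ x.2 h, DirectSum.decompose_of_mem_ne ℋ hpow,
        zero_pow (pow_ne_zero n (Fact.out : p.Prime).ne_zero)]
      intro h'
      exact h (nsmul_right_injective (pow_ne_zero n (Fact.out : p.Prime).ne_zero) h')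

theorem nonempty_gradedRing_rootGrade [GradedRing 𝒦] [GradedRing ℋ] [CharP K p]
    (hK : IsGradedAlgebra 𝒦 ℋ) : Nonempty (GradedRing (rootGrade p n k ℋ)) := by
  classical
  have : SetLike.GradedMonoid (rootGrade p n k ℋ) :=
    { one_mem := SetLike.GradedOne.one_mem (A := ℋ)
      mul_mem := fun γ δ x y hx hy =>
        mem_rootGrade_iff.mpr (SetLike.mul_mem_graded (A := ℋ) hx hy) }
  refine nonempty_gradedRing_of_injective (fun x => ?_)
    (rootSubalgebra p n k K).val.toRingHom.toAddMonoidHom Subtype.val_injective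
    (fun δ => GradedRing.proj ℋ δ) (fun γ x hx => DirectSum.decompose_of_mem_same ℋ hx)
    (fun γ δ h x hx => DirectSum.decompose_of_mem_ne ℋ hx h)
  have hx : x = ∑ i ∈ (DirectSum.decompose ℋ (x : K)).support,
      (⟨DirectSum.decompose ℋ (x : K) i, decompose_mem_rootSubalgebra hK x.2 i⟩ :
        rootSubalgebra p n k K) := by
    refine Subtype.ext ?_
    rw [AddSubmonoidClass.coe_finsetSum]
    exact (DirectSum.sum_support_decompose ℋ (x : K)).symm
  rw [hx]
  exact sum_mem fun i _ =>
    AddSubgroup.subset_closure ⟨i, (DirectSum.decompose ℋ (x : K) i).2⟩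

theorem isGradedField_rootGrade (hk : IsGradedField 𝒦) (hH : IsGradedField ℋ)
    (hK : IsGradedAlgebra 𝒦 ℋ) : IsGradedField (rootGrade p n k ℋ) := by
  obtain ⟨_⟩ := hk.graded
  obtain ⟨_⟩ := hH.graded
  have := hH.nontrivial
  have := hk.isDomain
  have hinj := hk.algebraMap_injective hK
  have := charP_of_injective_algebraMap hinj p
  refine ⟨nonempty_gradedRing_rootGrade hK, inferInstance, fun γ x hx hx0 => ?_⟩
  have hxK : (x : K) ≠ 0 := fun h => hx0 (Subtype.ext h)
  obtain ⟨y, hy⟩ := (hH.isUnit_of_ne_zero γ x hx hxK).exists_left_inv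
  have := hH.isDomain
  obtain ⟨a, ha⟩ := x.2
  have ha0 : a ≠ 0 := by
    rintro rfl
    rw [map_zero] at ha
    exact pow_ne_zero _ hxK ha.symm
  have hau : IsUnit a := by
    refine hk.isUnit_of_ne_zero (p ^ n • γ) a ?_ ha0
    refine mem_of_map_mem (𝒮 := ℋ) (algebraMap k K).toAddMonoidHom hK.algebraMap_mem hinj ?_
    exact ha.symm ▸ SetLike.pow_mem_graded (A := ℋ) (p ^ n) hx
  obtain ⟨c, hc⟩ := hau.exists_left_inv
  -- The inverse `y` of `x` in `K` lies in `k^{p^{-n}}`: both `y^{p^n}` and the image of `c` are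
  -- inverse to `x^{p^n}`.
  refine IsUnit.of_mul_eq_one (⟨y, c, ?_⟩ : rootSubalgebra p n k K)
    (Subtype.ext ((mul_comm _ _).trans hy))
  have h1 : algebraMap k K c * (x : K) ^ p ^ n = 1 := by
    rw [← ha, ← map_mul, hc, map_one]
  have h2 : y ^ p ^ n * (x : K) ^ p ^ n = 1 := by
    rw [← mul_pow, hy, one_pow]
  exact mul_right_cancel₀ (pow_ne_zero _ hxK) (h1.trans h2.symm)

theorem isGradedAlgebra_rootGrade (hk : IsGradedField 𝒦) (hH : IsGradedField ℋ)
    (hK : IsGradedAlgebra 𝒦 ℋ) : IsGradedAlgebra 𝒦 (rootGrade p n k ℋ) :=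
  ⟨(isGradedField_rootGrade hk hH hK).graded, fun γ x hx => hK.algebraMap_mem γ x hx⟩

/-- A root of the homogeneous polynomial `X^{p^n} - c` in the graded algebraic closure has its
`p^n`-th power in `k`. -/
theorem exists_root_mem_rootGrade (hK : IsGradedAlgClosure 𝒦 ℋ) {δ : Degree} {c : k}
    (hc : c ∈ 𝒦 (p ^ n • δ)) : ∃ x ∈ rootGrade p n k ℋ δ,
      algebraMap k (rootSubalgebra p n k K) c = x ^ p ^ n := by
  obtain ⟨_⟩ := hK.isGradedField.graded
  have := hK.isGradedField.nontrivial
  have hq : p ^ n ≠ 0 := pow_ne_zero n (Fact.out : p.Prime).ne_zero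
  obtain ⟨x, hx, h0⟩ := hK.exists_root δ (p ^ n • δ)
    (Polynomial.X ^ p ^ n - Polynomial.C (algebraMap k K c))
    (sub_mem (SetLike.pow_mem_graded _ (X_mem_polyGrade δ))
      (C_mem_polyGrade (hK.isGradedAlgebra.algebraMap_mem _ _ hc)))
    (by rw [Polynomial.natDegree_X_pow_sub_C]; exact Nat.pos_of_ne_zero hq)
  rw [Polynomial.eval_sub, Polynomial.eval_pow, Polynomial.eval_X, Polynomial.eval_C,
    sub_eq_zero] at h0
  exact ⟨⟨x, c, h0.symm⟩, hx, Subtype.ext h0.symm⟩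

end RootSubalgebra

end RussellGraded

/-! ### Both directions for `L = k^{p^{-n}}` -/

theorem mainTheorem2 (p : ℕ) [Fact p.Prime]
    {k : Type*} [CommRing k] [CharP k p] (𝒦 : Degree → AddSubgroup k)
    (hk : IsGradedField 𝒦)
    {K : Type*} [CommRing K] [Algebra k K] (ℋ : Degree → AddSubgroup K)
    (hK : IsGradedAlgClosure 𝒦 ℋ)
    (n : ℕ) (hn : 1 ≤ n) (r : Degree) :
    (∀ s : Degree,
      (∃ γ ∈ unitDegrees (rootGrade p n k ℋ), s = γ + r) →
      ∀ (m : ℕ) (a : Fin (m + 1) → k),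
        pPolynomial p a ∈ polyGrade 𝒦 (p ^ n • r) (p ^ n • s) →
        a 0 ≠ 0 →
        IsGradedHopfAlgebra 𝒦 (russellGrade p n a 𝒦 r s) ∧
        IsGradedForm k (rootGrade p n k ℋ)
          (russellGrade p n a 𝒦 r s) (polyGrade 𝒦 r)) ∧
    (∀ (A : Type*) [CommRing A] [HopfAlgebra k A] (𝒜 : Degree → AddSubgroup A),
      IsGradedHopfAlgebra 𝒦 𝒜 →
      IsGradedForm k (rootGrade p n k ℋ) 𝒜
        (polyGrade 𝒦 r) →
      ∃ s : Degree,
        (∃ γ ∈ unitDegrees (rootGrade p n k ℋ), s = γ + r) ∧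
        ∃ (m : ℕ) (a : Fin (m + 1) → k),
          pPolynomial p a ∈ polyGrade 𝒦 (p ^ n • r) (p ^ n • s) ∧
          a 0 ≠ 0 ∧
          ∃ e : A ≃ₐc[k] RussellAlgebra p n a,
            ∀ (γ : Degree) (x : A),
              e x ∈ russellGrade p n a 𝒦 r s γ ↔ x ∈ 𝒜 γ) := by

  have hH := hK.isGradedField
  have hKA := hK.isGradedAlgebra
  refine ⟨fun s _ m a ha ha0 => ?_, fun A _ _ 𝒜 h𝒜 hform => ?_⟩
  · exact isGradedHopfAlgebra_and_isGradedForm_russellGrade hk (isGradedField_rootGrade hk hH hKA)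
      (isGradedAlgebra_rootGrade hk hH hKA) (fun δ c hc => exists_root_mem_rootGrade hK hc) ha ha0
  · exact exists_bialgEquiv_russellAlgebra hk (isGradedField_rootGrade hk hH hKA)
      (isGradedAlgebra_rootGrade hk hH hKA) exists_algebraMap_rootSubalgebra_eq h𝒜 hform
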